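/- All graphs are finite and simple. Cographs are the graphs obtained from $K_1$ by repeatedly taking complements and disjoint unions. $G+H$ is the disjoint union of $G$ and $H$, $G\oplus H$ their join, $nG$ the disjoint union of $n$ copies of $G$, and $\overline{G}$ the complement of $G$. A cluster is the complement of a complete multipartite graph. A graph is $(\infty,k)$-polar if its vertex set can be partitioned into two (possibly empty) sets $A$ and $B$ such that $A$ induces a complete multipartite graph (with any number of parts) and $B$ induces a cluster with at most $k$ connected components. A cograph minimal $(\infty,k)$-polar obstruction is a cograph that is not $(\infty,k)$-polar but all of whose proper induced subgraphs are $(\infty,k)$-polar; it has type $(c,i)$ if it has exactly $c$ connected components and precisely $i$ of them consist of a single vertex. Let $p$ and $k$ be non-negative integers. 1. If $1\le p\le k+1$, then $pK_1+(k-p+1)K_2+K_{p,p}$ is a cograph minimal $(\infty,k)$-polar obstruction. Moreover, if $p\le k$, then up to isomorphism it is the only cograph minimal $(\infty,k)$-polar obstruction of type $(k+2,p)$. 2. If $1\le p\le k$, then $pK_1+(k-p)K_2+(\overline{K_2}\oplus(K_2+pK_1))$ is a cograph minimal $(\infty,k)$-polar obstruction. Moreover, if $p\le k-1$, then up to isomorphism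 it is the only cograph minimal $(\infty,k)$-polar obstruction of type $(k+1,p)$. 3. If $1\le p\le k-1$, then $pK_1+(k-p-1)K_2+(K_1\oplus(2K_2+pK_1))$ is a cograph minimal $(\infty,k)$-polar obstruction. Moreover, if $p\le k-2$, then up to isomorphism it is the only cograph minimal $(\infty,k)$-polar obstruction of type $(k,p)$. -/

import Mathlib

universe u

open SimpleGraph

namespace PolarCograph

/-- Cographs: `K₁` is a cograph, and cographs are closed under complementation and disjoint union
(and under isomorphism). -/
inductive IsCograph : ∀ {V : Type u}, SimpleGraph V → Prop
  | single : IsCograph (⊥ : SimpleGraph PUnit)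
  | compl {V : Type u} {G : SimpleGraph V} : IsCograph G → IsCograph Gᶜ
  | sum {V W : Type u} {G : SimpleGraph V} {H : SimpleGraph W} :
      IsCograph G → IsCograph H → IsCograph (G ⊕g H)
  | iso {V W : Type u} {G : SimpleGraph V} {H : SimpleGraph W} (e : G ≃g H) :
      IsCograph G → IsCograph H

/-- A cluster is the complement of a complete multipartite graph; a `k`-cluster is a cluster with
at most `k` components. -/
def IsClusterLE {V : Type*} (k : ℕ∞) (G : SimpleGraph V) : Prop :=
  Gᶜ.IsCompleteMultipartite ∧ ENat.card G.ConnectedComponent ≤ k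

/-- A complete multipartite graph with at most `s` parts; the parts of a complete multipartite
graph are the components of its complement. -/
def IsMultipartiteLE {V : Type*} (s : ℕ∞) (G : SimpleGraph V) : Prop :=
  G.IsCompleteMultipartite ∧ ENat.card Gᶜ.ConnectedComponent ≤ s

/-- `G` is `(s, k)`-polar: the vertex set has a partition `(A, B)`, one of the two sets being
possibly empty, such that `A` induces a complete `s`-partite graph and `B` induces a `k`-cluster.
The value `⊤` for `s` or `k` means that there is no bound. -/
def IsPolar {V : Type*} (s k : ℕ∞) (G : SimpleGraph V) : Prop :=
  ∃ A : Set V, IsMultipartiteLE s (G.induce A) ∧ IsClusterLE k (G.induce Aᶜ)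

/-- A cograph minimal `(s, k)`-polar obstruction. -/
def IsMinimalObstruction {V : Type u} (s k : ℕ∞) (G : SimpleGraph V) : Prop :=
  IsCograph G ∧ ¬ IsPolar s k G ∧ ∀ S : Set V, S ≠ Set.univ → IsPolar s k (G.induce S)

/-- `G` has exactly `c` connected components, and precisely `i` of them are trivial, that is,
consist of a single vertex. -/
def HasType {V : Type*} (c i : ℕ) (G : SimpleGraph V) : Prop :=
  ENat.card G.ConnectedComponent = c ∧
    {C : G.ConnectedComponent | ∃ v, C.supp = {v}}.encard = i

/-- The join `G ⊕ H`: the disjoint union with all the edges between the two sides added. -/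
def join {V W : Type*} (G : SimpleGraph V) (H : SimpleGraph W) : SimpleGraph (V ⊕ W) :=
  (G ⊕g H) ⊔ completeBipartiteGraph V W

/-- The disjoint union `n G` of `n` copies of `G`. -/
def copies {V : Type*} (n : ℕ) (G : SimpleGraph V) : SimpleGraph (Fin n × V) where
  Adj x y := x.1 = y.1 ∧ G.Adj x.2 y.2
  symm := ⟨fun _ _ h => ⟨h.1.symm, h.2.symm⟩⟩
  loopless := ⟨fun x h => G.loopless.irrefl x.2 h.2⟩

/-- The complete graph `Kₙ`. -/
abbrev K (n : ℕ) : SimpleGraph (Fin n) := ⊤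

/-- `a K₁ + b K₂ + H`. -/
abbrev withSmall {V : Type*} (a b : ℕ) (H : SimpleGraph V) :
    SimpleGraph ((Fin a × Fin 1 ⊕ Fin b × Fin 2) ⊕ V) :=
  (copies a (K 1) ⊕g copies b (K 2)) ⊕g H

end PolarCograph

namespace PolarCograph

/-- `A` induces a complete multipartite graph in `G`. -/
def CMOn {V : Type*} (G : SimpleGraph V) (A : Set V) : Prop :=
  ∀ x ∈ A, ∀ y ∈ A, ∀ z ∈ A, ¬ G.Adj x y → ¬ G.Adj y z → ¬ G.Adj x z

/-- `A` is independent in `G`. -/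
def IndepOn {V : Type*} (G : SimpleGraph V) (A : Set V) : Prop :=
  ∀ x ∈ A, ∀ y ∈ A, ¬ G.Adj x y

/-- `c` and `s` exhibit the subgraph of `G` induced by `B` as a cluster whose components are the
colour classes of `c`, with colours in `s`. -/
structure IsClusterColoring {V : Type*} (G : SimpleGraph V) (B : Set V) (c : V → ℕ)
    (s : Finset ℕ) : Prop where
  mem : ∀ x ∈ B, c x ∈ s
  adj_iff : ∀ x ∈ B, ∀ y ∈ B, x ≠ y → (G.Adj x y ↔ c x = c y)

/-- `B` induces in `G` a cluster with at most `m` components. -/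
def ClusterOn {V : Type*} (G : SimpleGraph V) (B : Set V) (m : ℕ) : Prop :=
  ∃ c s, s.card ≤ m ∧ IsClusterColoring G B c s

/-- The subgraph of `G` induced by `S` is `(∞, m)`-polar. -/
def PolarOn {V : Type*} (G : SimpleGraph V) (S : Set V) (m : ℕ) : Prop :=
  ∃ A, CMOn G A ∧ ClusterOn G (S \ A) m

/-- The subgraph of `G` induced by `S` is `(1, m)`-polar. -/
def SplitOn {V : Type*} (G : SimpleGraph V) (S : Set V) (m : ℕ) : Prop :=
  ∃ A, IndepOn G A ∧ ClusterOn G (S \ A) m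

section Basic

variable {V W : Type*} {G : SimpleGraph V} {H : SimpleGraph W}

lemma CMOn.mono {A A' : Set V} (h : CMOn G A) (hA : A' ⊆ A) : CMOn G A' :=
  fun x hx y hy z hz => h x (hA hx) y (hA hy) z (hA hz)

lemma IndepOn.mono {A A' : Set V} (h : IndepOn G A) (hA : A' ⊆ A) : IndepOn G A' :=
  fun x hx y hy => h x (hA hx) y (hA hy)

lemma IndepOn.cmOn {A : Set V} (h : IndepOn G A) : CMOn G A :=
  fun x hx _ _ z hz _ _ => h x hx z hz

lemma IsClusterColoring.mono {B B' : Set V} {c : V → ℕ} {s : Finset ℕ}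
    (h : IsClusterColoring G B c s) (hB : B' ⊆ B) : IsClusterColoring G B' c s :=
  ⟨fun x hx => h.mem x (hB hx), fun x hx y hy => h.adj_iff x (hB hx) y (hB hy)⟩

lemma ClusterOn.mono {B B' : Set V} {m m' : ℕ} (h : ClusterOn G B m) (hB : B' ⊆ B)
    (hm : m ≤ m') : ClusterOn G B' m' := by
  obtain ⟨c, s, hs, hc⟩ := h
  exact ⟨c, s, hs.trans hm, hc.mono hB⟩

lemma PolarOn.mono {S S' : Set V} {m m' : ℕ} (h : PolarOn G S m) (hS : S' ⊆ S)
    (hm : m ≤ m') : PolarOn G S' m' := by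
  obtain ⟨A, hA, hB⟩ := h
  exact ⟨A, hA, hB.mono (Set.sdiff_subset_sdiff_left hS) hm⟩

lemma SplitOn.mono {S S' : Set V} {m m' : ℕ} (h : SplitOn G S m) (hS : S' ⊆ S)
    (hm : m ≤ m') : SplitOn G S' m' := by
  obtain ⟨A, hA, hB⟩ := h
  exact ⟨A, hA, hB.mono (Set.sdiff_subset_sdiff_left hS) hm⟩

lemma CMOn.preimage {A : Set V} (h : CMOn G A) (f : H ↪g G) : CMOn H (f ⁻¹' A) := by
  intro x hx y hy z hz
  rw [← f.map_adj_iff, ← f.map_adj_iff, ← f.map_adj_iff]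
  exact h _ hx _ hy _ hz

lemma IndepOn.preimage {A : Set V} (h : IndepOn G A) (f : H ↪g G) : IndepOn H (f ⁻¹' A) := by
  intro x hx y hy
  rw [← f.map_adj_iff]
  exact h _ hx _ hy

lemma ClusterOn.preimage {B : Set V} {m : ℕ} (h : ClusterOn G B m) (f : H ↪g G) :
    ClusterOn H (f ⁻¹' B) m := by
  obtain ⟨c, s, hs, hc⟩ := h
  refine ⟨c ∘ f, s, hs, fun x hx => hc.mem _ hx, fun x hx y hy hxy => ?_⟩
  rw [← f.map_adj_iff]
  exact hc.adj_iff _ hx _ hy (f.injective.ne hxy)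

lemma PolarOn.preimage {S : Set V} {m : ℕ} (h : PolarOn G S m) (f : H ↪g G) :
    PolarOn H (f ⁻¹' S) m := by
  obtain ⟨A, hA, hB⟩ := h
  exact ⟨f ⁻¹' A, hA.preimage f, hB.preimage f⟩

lemma SplitOn.preimage {S : Set V} {m : ℕ} (h : SplitOn G S m) (f : H ↪g G) :
    SplitOn H (f ⁻¹' S) m := by
  obtain ⟨A, hA, hB⟩ := h
  exact ⟨f ⁻¹' A, hA.preimage f, hB.preimage f⟩

lemma CMOn.image {A : Set W} (h : CMOn H A) (f : H ↪g G) : CMOn G (f '' A) := by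
  rintro _ ⟨x, hx, rfl⟩ _ ⟨y, hy, rfl⟩ _ ⟨z, hz, rfl⟩
  simp only [f.map_adj_iff]
  exact h _ hx _ hy _ hz

lemma ClusterOn.image {B : Set W} {m : ℕ} (h : ClusterOn H B m) (f : H ↪g G) :
    ClusterOn G (f '' B) m := by
  obtain ⟨c, s, hs, hc⟩ := h
  refine ⟨Function.extend f c 0, s, hs, ?_, ?_⟩
  · rintro _ ⟨x, hx, rfl⟩
    rw [f.injective.extend_apply]
    exact hc.mem _ hx
  · rintro _ ⟨x, hx, rfl⟩ _ ⟨y, hy, rfl⟩ hxy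
    rw [f.injective.extend_apply, f.injective.extend_apply, f.map_adj_iff]
    exact hc.adj_iff _ hx _ hy (fun h => hxy (h ▸ rfl))

lemma PolarOn.image {S : Set W} {m : ℕ} (h : PolarOn H S m) (f : H ↪g G) :
    PolarOn G (f '' S) m := by
  obtain ⟨A, hA, hB⟩ := h
  exact ⟨f '' A, hA.image f, (Set.image_sdiff f.injective S A) ▸ hB.image f⟩

lemma image_induce_univ (S : Set V) : Embedding.induce (G := G) S '' Set.univ = S := by
  rw [Set.image_univ]
  exact Subtype.range_coe

lemma cmOn_univ_iff : CMOn G Set.univ ↔ G.IsCompleteMultipartite :=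
  ⟨fun h => ⟨fun x y z => h x trivial y trivial z trivial⟩,
    fun h x _ y _ z _ => h.trans x y z⟩

lemma clusterOn_univ_iff {m : ℕ} : ClusterOn G Set.univ m ↔ IsClusterLE m G := by
  constructor
  · rintro ⟨c, s, hs, hc⟩
    have key : ∀ x y, x = y ∨ G.Adj x y ↔ c x = c y := fun x y => by
      by_cases hxy : x = y
      · simp [hxy]
      · simp [hxy, hc.adj_iff x trivial y trivial hxy]
    refine ⟨⟨fun x y z hxy hyz => ?_⟩, ?_⟩
    · simp only [compl_adj, ne_eq, not_and_or, not_not, key] at *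
      exact hxy.trans hyz
    · have hinj : Function.Injective
          (fun C : G.ConnectedComponent => (⟨c C.out, hc.mem _ trivial⟩ : s)) := by
        intro C D hCD
        have h := (key _ _).2 (congrArg Subtype.val hCD)
        rw [← C.out_eq, ← D.out_eq]
        rcases h with h | h
        · rw [h]
        · exact ConnectedComponent.sound h.reachable
      have := Finite.of_injective _ hinj
      have h1 := Nat.card_le_card_of_injective _ hinj
      rw [ENat.card_eq_coe_natCard]
      rw [Nat.card_eq_fintype_card (α := s), Fintype.card_coe] at h1
      exact_mod_cast h1.trans hs
  · rintro ⟨htr, hcard⟩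
    have hfin : Finite G.ConnectedComponent := by
      rw [← ENat.card_lt_top]
      exact hcard.trans_lt (ENat.natCast_lt_top m)
    rw [ENat.card_eq_coe_natCard] at hcard
    have hcard : Nat.card G.ConnectedComponent ≤ m := by exact_mod_cast hcard
    let e := Finite.equivFin G.ConnectedComponent
    refine ⟨fun x => e (G.connectedComponentMk x), Finset.range (Nat.card G.ConnectedComponent),
      by simpa using hcard, fun x _ => by simp, fun x _ y _ hxy => ?_⟩
    constructor
    · intro h
      simp only [Fin.val_inj, e.apply_eq_iff_eq]
      exact ConnectedComponent.sound h.reachable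
    · intro h
      simp only [Fin.val_inj, e.apply_eq_iff_eq] at h
      have hr : G.Reachable x y := ConnectedComponent.exact h
      have : ¬ Gᶜ.Adj x y := by
        clear hxy h
        obtain ⟨w⟩ := hr
        induction w with
        | nil => simp
        | cons h1 _ ih => exact htr.trans _ _ _ (by simp [h1]) (ih trivial trivial)
      simpa [hxy] using this

lemma isPolar_iff {m : ℕ} : IsPolar ⊤ m G ↔ PolarOn G Set.univ m := by
  unfold IsPolar
  have h1 : ∀ A : Set V, IsMultipartiteLE ⊤ (G.induce A) ↔ CMOn G A := fun A => by
    simp only [IsMultipartiteLE, le_top, and_true, ← cmOn_univ_iff]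
    constructor
    · intro h
      simpa only [image_induce_univ] using h.image (Embedding.induce A)
    · intro h
      exact (h.preimage (Embedding.induce A)).mono (fun x _ => x.2)
  have h2 : ∀ A : Set V, IsClusterLE m (G.induce A) ↔ ClusterOn G A m := fun A => by
    rw [← clusterOn_univ_iff]
    constructor
    · intro h
      simpa only [image_induce_univ] using h.image (Embedding.induce A)
    · intro h
      exact (h.preimage (Embedding.induce A)).mono (fun x _ => x.2) le_rfl
  simp only [h1, h2, PolarOn, Set.compl_eq_univ_sdiff]

lemma isPolar_induce_iff {m : ℕ} {S : Set V} : IsPolar ⊤ m (G.induce S) ↔ PolarOn G S m := by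
  rw [isPolar_iff]
  constructor
  · intro h
    simpa only [image_induce_univ] using h.image (Embedding.induce S)
  · intro h
    exact (h.preimage (Embedding.induce S)).mono (fun x _ => x.2) le_rfl

/-- Clusters without edges between them form a cluster. -/
lemma ClusterOn.union {B₁ B₂ B : Set V} {m₁ m₂ : ℕ} (h₁ : ClusterOn G B₁ m₁)
    (h₂ : ClusterOn G B₂ m₂) (h : ∀ x ∈ B₁, ∀ y ∈ B₂, ¬ G.Adj x y ∧ x ≠ y) (hB : B ⊆ B₁ ∪ B₂) :
    ClusterOn G B (m₁ + m₂) := by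
  classical
  obtain ⟨c₁, s₁, hs₁, hc₁⟩ := h₁
  obtain ⟨c₂, s₂, hs₂, hc₂⟩ := h₂
  refine ClusterOn.mono (B := B₁ ∪ B₂) ⟨fun x => if x ∈ B₁ then 2 * c₁ x else 2 * c₂ x + 1,
    s₁.image (2 * ·) ∪ s₂.image (2 * · + 1), ?_, ?_, ?_⟩ hB le_rfl
  · refine (Finset.card_union_le _ _).trans (add_le_add ?_ ?_)
    · exact Finset.card_image_le.trans hs₁
    · exact Finset.card_image_le.trans hs₂
  · intro x hx
    by_cases hx1 : x ∈ B₁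
    · simp only [hx1, if_true, Finset.mem_union, Finset.mem_image]
      exact Or.inl ⟨_, hc₁.mem x hx1, rfl⟩
    · simp only [hx1, if_false, Finset.mem_union, Finset.mem_image]
      exact Or.inr ⟨_, hc₂.mem x (hx.resolve_left hx1), rfl⟩
  · intro x hx y hy hxy
    by_cases hx1 : x ∈ B₁ <;> by_cases hy1 : y ∈ B₁
    · simp only [hx1, hy1, if_true, hc₁.adj_iff x hx1 y hy1 hxy]
      omega
    · simp only [hx1, hy1, if_true, if_false, (h x hx1 y (hy.resolve_left hy1)).1, false_iff]
      omega
    · have := (h y hy1 x (hx.resolve_left hx1)).1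
      rw [G.adj_comm] at this
      simp only [hx1, hy1, if_true, if_false, this, false_iff]
      omega
    · simp only [hx1, hy1, if_false, hc₂.adj_iff x (hx.resolve_left hx1) y
        (hy.resolve_left hy1) hxy]
      omega

/-- Removing `n` components of a cluster. -/
lemma ClusterOn.remove {B B' : Set V} {k : ℕ} (h : ClusterOn G B k) {ι : Type*} [Fintype ι]
    (r : ι → V) (hr : ∀ i, r i ∈ B) (hind : ∀ i j, i ≠ j → ¬ G.Adj (r i) (r j) ∧ r i ≠ r j)
    (hB' : ∀ x ∈ B', x ∈ B ∧ ∀ i, ¬ G.Adj (r i) x ∧ r i ≠ x) :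
    ∃ m, Fintype.card ι + m ≤ k ∧ ClusterOn G B' m := by
  classical
  obtain ⟨c, s, hs, hc⟩ := h
  have hinj : Function.Injective (c ∘ r) := by
    intro i j hij
    by_contra hne
    exact (hind i j hne).1 ((hc.adj_iff _ (hr i) _ (hr j) (hind i j hne).2).2 hij)
  have hsub : Finset.univ.image (c ∘ r) ⊆ s := by
    intro n hn
    obtain ⟨i, -, rfl⟩ := Finset.mem_image.1 hn
    exact hc.mem _ (hr i)
  have hcard := Finset.card_sdiff_add_card_eq_card hsub
  rw [Finset.card_image_of_injective _ hinj, Finset.card_univ] at hcard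
  refine ⟨(s \ Finset.univ.image (c ∘ r)).card, by omega, c, _, le_rfl, ?_, ?_⟩
  · intro x hx
    obtain ⟨h1, h2⟩ := hB' x hx
    simp only [Finset.mem_sdiff, hc.mem x h1, Finset.mem_image, Finset.mem_univ, true_and,
      Function.comp_apply, not_exists]
    intro i hi
    exact (h2 i).1 ((hc.adj_iff _ (hr i) _ h1 (h2 i).2).2 hi)
  · exact fun x hx y hy => hc.adj_iff x (hB' x hx).1 y (hB' y hy).1

lemma ClusterOn.card_le {B : Set V} {k : ℕ} (h : ClusterOn G B k) {ι : Type*} [Fintype ι]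
    (r : ι → V) (hr : ∀ i, r i ∈ B) (hind : ∀ i j, i ≠ j → ¬ G.Adj (r i) (r j) ∧ r i ≠ r j) :
    Fintype.card ι ≤ k := by
  obtain ⟨m, hm, -⟩ := h.remove (B' := ∅) r hr hind (by simp)
  omega

/-- In a cluster, adjacency-or-equality is transitive. -/
lemma ClusterOn.adj_trans {B : Set V} {k : ℕ} (h : ClusterOn G B k) {x y z : V} (hx : x ∈ B)
    (hy : y ∈ B) (hz : z ∈ B) (hxy : G.Adj x y) (hyz : G.Adj y z) (hxz : x ≠ z) : G.Adj x z := by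
  obtain ⟨c, s, -, hc⟩ := h
  rw [hc.adj_iff x hx y hy hxy.ne] at hxy
  rw [hc.adj_iff y hy z hz hyz.ne] at hyz
  rw [hc.adj_iff x hx z hz hxz, hxy, hyz]

lemma clusterOn_empty {B : Set V} (hB : B = ∅) : ClusterOn G B 0 :=
  ⟨0, ∅, by simp, by simp [hB], by simp [hB]⟩

/-- An independent set as a cluster. -/
lemma clusterOn_of_indepOn {B : Set V} (hB : IndepOn G B) (hf : B.Finite) :
    ClusterOn G B B.ncard := by
  have := hf.to_subtype
  classical
  let e := Finite.equivFin B
  refine ⟨fun x => if h : x ∈ B then e ⟨x, h⟩ else 0, Finset.range (Nat.card B), by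
    simp [Nat.card_coe_set_eq], fun x hx => ?_, fun x hx y hy hxy => ?_⟩
  · simp [hx]
  · simp only [hB x hx y hy, hx, hy, dif_pos, Fin.val_inj, e.apply_eq_iff_eq, Subtype.mk.injEq, hxy]

lemma clusterOn_of_clique {B : Set V} (hB : ∀ x ∈ B, ∀ y ∈ B, x ≠ y → G.Adj x y) :
    ClusterOn G B 1 :=
  ⟨0, {0}, by simp, by simp, fun x hx y hy hxy => by simp [hB x hx y hy hxy]⟩

end Basic

/-- Every set of at least two vertices splits into two nonempty parts with all or no edges
between them. -/
def CographLike {V : Type*} (G : SimpleGraph V) : Prop :=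
  ∀ S : Set V, S.Nontrivial → ∃ X ⊆ S, X.Nonempty ∧ (S \ X).Nonempty ∧
    ((∀ x ∈ X, ∀ y ∈ S \ X, G.Adj x y) ∨ (∀ x ∈ X, ∀ y ∈ S \ X, ¬ G.Adj x y))

section Cograph

variable {V W : Type*} {G : SimpleGraph V} {H : SimpleGraph W}

lemma CographLike.of_subsingleton [Subsingleton V] : CographLike G :=
  fun _ hS => absurd hS (Set.not_nontrivial_iff.2 (Set.subsingleton_of_subsingleton))

lemma CographLike.compl (h : CographLike G) : CographLike Gᶜ := by
  intro S hS
  obtain ⟨X, hXS, hX, hY, hXY⟩ := h S hS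
  refine ⟨X, hXS, hX, hY, ?_⟩
  have hne : ∀ x ∈ X, ∀ y ∈ S \ X, x ≠ y := fun x hx y hy hxy => hy.2 (hxy ▸ hx)
  rcases hXY with h | h
  · exact Or.inr fun x hx y hy => by simp [h x hx y hy]
  · exact Or.inl fun x hx y hy => by simp [h x hx y hy, hne x hx y hy]

lemma CographLike.exists_of_image (h : CographLike H) (f : H ↪g G) {S : Set V}
    (hS : S.Nontrivial) (hSf : S ⊆ Set.range f) : ∃ X ⊆ S, X.Nonempty ∧ (S \ X).Nonempty ∧
    ((∀ x ∈ X, ∀ y ∈ S \ X, G.Adj x y) ∨ (∀ x ∈ X, ∀ y ∈ S \ X, ¬ G.Adj x y)) := by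
  obtain ⟨T, rfl⟩ := Set.subset_range_iff_exists_image_eq.1 hSf
  obtain ⟨X, hXS, hX, hY, hXY⟩ := h T (Set.nontrivial_of_image f T hS)
  refine ⟨f '' X, Set.image_mono hXS, hX.image f, ?_, ?_⟩ <;>
    rw [← Set.image_sdiff f.injective]
  · exact hY.image f
  · simpa only [Set.forall_mem_image, f.map_adj_iff] using hXY

lemma CographLike.comap (h : CographLike G) (f : H ↪g G) : CographLike H := by
  intro S hS
  obtain ⟨X, hXS, hX, hY, hXY⟩ := h (f '' S) (hS.image f.injective)
  obtain ⟨X, rfl⟩ := Set.subset_range_iff_exists_image_eq.1 (hXS.trans (Set.image_subset_range f S))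
  rw [← Set.image_sdiff f.injective] at hY hXY
  refine ⟨X, (Set.image_subset_image_iff f.injective).1 hXS, hX.of_image, hY.of_image, ?_⟩
  simpa only [Set.forall_mem_image, f.map_adj_iff] using hXY

lemma CographLike.sum (hG : CographLike G) (hH : CographLike H) : CographLike (G ⊕g H) := by
  intro S hS
  by_cases h1 : S ⊆ Set.range Sum.inl
  · exact hG.exists_of_image Embedding.sumInl hS h1
  by_cases h2 : S ⊆ Set.range Sum.inr
  · exact hH.exists_of_image Embedding.sumInr hS h2
  obtain ⟨x, hx, hx'⟩ := Set.not_subset.1 h1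
  obtain ⟨y, hy, hy'⟩ := Set.not_subset.1 h2
  rcases x with x | x
  · simp at hx'
  rcases y with y | y
  swap
  · simp at hy'
  refine ⟨S ∩ Set.range Sum.inl, Set.inter_subset_left, ⟨_, hy, by simp⟩, ⟨_, hx, by simp⟩,
    Or.inr ?_⟩
  rintro _ ⟨_, z, rfl⟩ (w | w) ⟨hw, hw'⟩
  · simp [hw] at hw'
  · simp

lemma IsCograph.cographLike {V : Type u} {G : SimpleGraph V} (h : IsCograph G) :
    CographLike G ∧ Nonempty V := by
  induction h with
  | single => exact ⟨CographLike.of_subsingleton, inferInstance⟩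
  | compl _ ih => exact ⟨ih.1.compl, ih.2⟩
  | sum _ _ ih1 ih2 => exact ⟨ih1.1.sum ih2.1, ih1.2.map Sum.inl⟩
  | iso e _ ih => exact ⟨ih.1.comap e.symm.toEmbedding, ih.2.map e⟩

/-- A partition without edges between the parts exhibits a disjoint union. -/
lemma nonempty_iso_sum_of_partition (X : Set V) (h : ∀ x ∈ X, ∀ y ∉ X, ¬ G.Adj x y) :
    Nonempty (G.induce X ⊕g G.induce Xᶜ ≃g G) := by
  classical
  refine ⟨⟨Equiv.Set.sumCompl X, ?_⟩⟩
  rintro (⟨a, ha⟩ | ⟨a, ha⟩) (⟨b, hb⟩ | ⟨b, hb⟩)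
  · simp
  · simpa using h a ha b hb
  · simpa [G.adj_comm] using h b hb a ha
  · simp

lemma CographLike.isCograph_of_card (n : ℕ) : ∀ {V : Type u} [Finite V] [Nonempty V]
    {G : SimpleGraph V}, Nat.card V = n → CographLike G → IsCograph G := by
  induction n using Nat.strong_induction_on with
  | _ n ih =>
    intro V _ _ G hn hG
    rcases subsingleton_or_nontrivial V with hs | hs
    · obtain ⟨x⟩ := ‹Nonempty V›
      have := uniqueOfSubsingleton x
      refine IsCograph.iso (G := ⊥) ⟨Equiv.ofUnique PUnit V, ?_⟩ IsCograph.single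
      intro a b
      simp [Subsingleton.elim _ x]
    · have key : ∀ {G : SimpleGraph V}, CographLike G → ∀ X : Set V, X.Nonempty → Xᶜ.Nonempty →
          (∀ x ∈ X, ∀ y ∉ X, ¬ G.Adj x y) → IsCograph G := by
        intro G hG X hX hY h
        obtain ⟨e⟩ := nonempty_iso_sum_of_partition X h
        have := hX.to_subtype
        have := hY.to_subtype
        refine IsCograph.iso e (IsCograph.sum ?_ ?_)
        · refine ih (Nat.card X) ?_ rfl (hG.comap (Embedding.induce X))
          rw [← hn]
          obtain ⟨y, hy⟩ := hY
          exact Finite.card_subtype_lt hy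
        · refine ih (Nat.card ↥Xᶜ) ?_ rfl (hG.comap (Embedding.induce Xᶜ))
          rw [← hn]
          obtain ⟨y, hy⟩ := hX
          exact Finite.card_subtype_lt (x := y) (by simpa using hy)
      obtain ⟨X, -, hX, hY, h | h⟩ := hG Set.univ Set.nontrivial_univ
      · rw [← compl_compl G]
        refine IsCograph.compl (key hG.compl X hX (by simpa [Set.compl_eq_univ_sdiff] using hY)
          fun x hx y hy => ?_)
        simp [h x hx y ⟨trivial, hy⟩]
      · exact key hG X hX (by simpa [Set.compl_eq_univ_sdiff] using hY)
          fun x hx y hy => h x hx y ⟨trivial, hy⟩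

lemma isCograph_iff {V : Type u} [Finite V] {G : SimpleGraph V} :
    IsCograph G ↔ CographLike G ∧ Nonempty V :=
  ⟨IsCograph.cographLike, fun ⟨h, _⟩ => CographLike.isCograph_of_card _ rfl h⟩

@[simp]
lemma copies_adj {n : ℕ} {x y : Fin n × V} :
    (copies n G).Adj x y ↔ x.1 = y.1 ∧ G.Adj x.2 y.2 := Iff.rfl

lemma CographLike.copies (n : ℕ) (h : CographLike G) : CographLike (copies n G) := by
  intro S hS
  obtain ⟨x, hx, -⟩ := id hS
  by_cases h1 : ∃ y ∈ S, y.1 ≠ x.1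
  · obtain ⟨y, hy, hyx⟩ := h1
    refine ⟨{z ∈ S | z.1 = x.1}, Set.sep_subset _ _, ⟨x, hx, rfl⟩, ⟨y, hy, fun h => hyx h.2⟩,
      Or.inr ?_⟩
    rintro a ⟨_, ha⟩ b ⟨hb, hb'⟩ hab
    exact hb' ⟨hb, hab.1 ▸ ha⟩
  · push Not at h1
    let f : G ↪g PolarCograph.copies n G :=
      ⟨⟨fun v => (x.1, v), fun a b hab => (Prod.ext_iff.1 hab).2⟩,  @fun a b => and_iff_right rfl⟩
    exact h.exists_of_image f hS fun y hy => ⟨y.2, Prod.ext (h1 y hy).symm rfl⟩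

lemma join_eq_compl : join G H = (Gᶜ ⊕g Hᶜ)ᶜ := by
  ext (a | a) (b | b)
  · simp [join]
    exact ⟨fun h => ⟨G.ne_of_adj h, fun _ => h⟩, fun h => h.2 h.1⟩
  · simp [join]
  · simp [join]
  · simp [join]
    exact ⟨fun h => ⟨H.ne_of_adj h, fun _ => h⟩, fun h => h.2 h.1⟩

lemma CographLike.join (hG : CographLike G) (hH : CographLike H) :
    CographLike (PolarCograph.join G H) := by
  rw [join_eq_compl]
  exact (hG.compl.sum hH.compl).compl

lemma CographLike.bot : CographLike (⊥ : SimpleGraph V) := by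
  intro S hS
  obtain ⟨x, hx, y, hy, hxy⟩ := hS
  exact ⟨{x}, by simpa, ⟨x, rfl⟩, ⟨y, hy, hxy.symm⟩, Or.inr (by simp)⟩

lemma CographLike.top : CographLike (⊤ : SimpleGraph V) := by
  rw [← compl_bot]
  exact CographLike.bot.compl

end Cograph

end PolarCograph

namespace PolarCograph

section WithSmall

variable {V W : Type*} {G : SimpleGraph V} {H : SimpleGraph W}

lemma cmOn_of_clique {A : Set V} (h : ∀ x ∈ A, ∀ y ∈ A, x ≠ y → G.Adj x y) : CMOn G A := by
  intro x hx y hy z hz hxy hyz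
  by_cases hne : x = y
  · rwa [hne]
  · exact absurd (h x hx y hy hne) hxy

/-- All the vertices of `withSmall a b H`, except those of `H` outside `S`. -/
def fullOver {a b : ℕ} (S : Set W) : Set ((Fin a × Fin 1 ⊕ Fin b × Fin 2) ⊕ W) :=
  {x | ∀ v, x = .inr v → v ∈ S}

@[simp] lemma inl_mem_fullOver {a b : ℕ} {S : Set W} (x : Fin a × Fin 1 ⊕ Fin b × Fin 2) :
    Sum.inl x ∈ fullOver S := fun _ h => nomatch h

@[simp] lemma inr_mem_fullOver {a b : ℕ} {S : Set W} (x : W) :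
    (Sum.inr x : (Fin a × Fin 1 ⊕ Fin b × Fin 2) ⊕ W) ∈ fullOver S ↔ x ∈ S :=
  ⟨fun h => h x rfl, fun h v hv => by rwa [← Sum.inr_injective hv]⟩

lemma fullOver_univ {a b : ℕ} :
    (fullOver Set.univ : Set ((Fin a × Fin 1 ⊕ Fin b × Fin 2) ⊕ W)) = Set.univ := by
  ext (x | x) <;> simp

lemma fullOver_compl_singleton {a b : ℕ} (v : W) :
    (fullOver {v}ᶜ : Set ((Fin a × Fin 1 ⊕ Fin b × Fin 2) ⊕ W)) = {.inr v}ᶜ := by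
  ext (x | x) <;> simp

lemma preimage_image_inr {a b : ℕ} (S : Set W) :
    (Embedding.sumInr : H ↪g (copies a (K 1) ⊕g copies b (K 2)) ⊕g H) ⁻¹' (Sum.inr '' S) = S :=
  Set.preimage_image_eq _ Sum.inr_injective

lemma PolarOn.of_withSmall {a b k : ℕ} {S : Set W} (hS : S.Nonempty)
    (h : PolarOn (withSmall a b H) (fullOver S) k) :
    (∃ m, b + m ≤ k ∧ SplitOn H S m) ∨ (∃ m, a + b + m ≤ k ∧ PolarOn H S m) := by
  obtain ⟨A, hA, hB⟩ := h
  by_cases hind : IndepOn (withSmall a b H) A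
  · left
    have hj : ∀ i : Fin b, ∃ j : Fin 2, (.inl (.inr (i, j))) ∉ A := by
      intro i
      by_contra! hcon
      exact hind _ (hcon 0) _ (hcon 1) (by simp)
    choose j hj using hj
    obtain ⟨m, hm, hm'⟩ := hB.remove (B' := Sum.inr '' (S \ Sum.inr ⁻¹' A))
      (fun i => .inl (.inr (i, j i))) (fun i => ⟨by simp, hj i⟩)
      (fun i i' hii => by simp [hii]) (by
        rintro _ ⟨x, hx, rfl⟩
        exact ⟨⟨by simpa using hx.1, hx.2⟩, by simp⟩)
    have := hm'.preimage (H := H) Embedding.sumInr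
    rw [preimage_image_inr] at this
    exact ⟨m, by simpa using hm, Sum.inr ⁻¹' A, hind.preimage Embedding.sumInr, this⟩
  · right
    simp only [IndepOn, not_forall, not_not] at hind
    obtain ⟨x, hx, y, hy, hxy⟩ := hind
    have hout : ∀ z, ¬ (withSmall a b H).Adj x z → ¬ (withSmall a b H).Adj z y → z ∉ A :=
      fun z h1 h2 hz => hA x hx z hz y hy h1 h2 hxy
    rcases x with x | x <;> rcases y with y | y
    · obtain ⟨i, rest⟩ : ∃ i : Fin b, ∀ z, (∀ j, z ≠ .inl (.inr (i, j))) → z ∉ A := by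
        rcases x with x | x <;> rcases y with y | y
        · simp [Subsingleton.elim x.2 y.2] at hxy
        · simp at hxy
        · simp at hxy
        · refine ⟨x.1, fun z hz => hout z ?_ ?_⟩
          · rintro hadj
            rcases z with (z | z) | z
            · simp at hadj
            · simp only [sum_adj, copies_adj] at hadj
              exact hz z.2 (by rw [hadj.1])
            · simp at hadj
          · rintro hadj
            simp only [sum_adj, copies_adj] at hxy
            rcases z with (z | z) | z
            · simp at hadj
            · simp only [sum_adj, copies_adj] at hadj
              exact hz z.2 (by rw [hxy.1, ← hadj.1])
            · simp at hadj
      obtain ⟨w, hw⟩ := hS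
      obtain ⟨m, hm, hm'⟩ := hB.remove (B' := Sum.inr '' {h ∈ S | ¬ H.Adj w h ∧ w ≠ h})
        (Sum.elim (fun i' : Fin a => .inl (.inl (i', 0)))
          (fun i' : Fin b => if i' = i then .inr w else .inl (.inr (i', 0))))
        (by
          rintro (i' | i')
          · exact ⟨by simp, rest _ (by simp)⟩
          · simp only [Sum.elim_inr]
            split_ifs with h
            · exact ⟨by simpa, rest _ (by simp)⟩
            · exact ⟨by simp, rest _ (by simp [h])⟩)
        (by
          rintro (i₁ | i₁) (i₂ | i₂) hne <;> simp only [Sum.elim_inl, Sum.elim_inr]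
          · simp at hne ⊢
            exact fun h => (hne h).elim
          · split_ifs <;> simp
          · split_ifs <;> simp
          · simp only [ne_eq, Sum.inr.injEq] at hne
            split_ifs with h1 h2 h2
            · exact (hne (h1.trans h2.symm)).elim
            · simp
            · simp
            · simp [hne])
        (by
          rintro _ ⟨x, hx, rfl⟩
          refine ⟨⟨by simpa using hx.1, rest _ (by simp)⟩, ?_⟩
          rintro (i' | i')
          · simp
          · simp only [Sum.elim_inr]
            split_ifs
            · simpa using hx.2
            · simp)
      have hm' := hm'.preimage (H := H) Embedding.sumInr
      rw [preimage_image_inr] at hm'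
      refine ⟨m, by simpa using hm, {h ∈ S | w = h ∨ H.Adj w h}, cmOn_of_clique ?_,
        hm'.mono ?_ le_rfl⟩
      · have hmem : ∀ z ∈ S, (Sum.inr z) ∈ fullOver S \ A :=
          fun z hz => ⟨by simpa, rest _ (by simp)⟩
        have hw' := hmem w hw
        rintro u ⟨hu, rfl | hu'⟩ v ⟨hv, hv'⟩ huv
        · exact hv'.resolve_left huv
        · rcases hv' with rfl | hv'
          · exact hu'.symm
          · have h3 := hB.adj_trans (hmem u hu) hw' (hmem v hv) (by simpa using hu'.symm)
              (by simpa using hv') (by simpa using huv)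
            simpa using h3
      · intro z hz
        refine ⟨hz.1, fun h => hz.2 ⟨hz.1, Or.inr h⟩, fun h => hz.2 ⟨hz.1, Or.inl h⟩⟩
    · simp at hxy
    · simp at hxy
    · have hinl : ∀ z, Sum.inl z ∉ A := fun z => hout _ (by simp) (by simp)
      obtain ⟨m, hm, hm'⟩ := hB.remove (B' := Sum.inr '' (S \ Sum.inr ⁻¹' A))
        (Sum.elim (fun i : Fin a => .inl (.inl (i, 0))) (fun i : Fin b => .inl (.inr (i, 0))))
        (by rintro (i | i) <;> exact ⟨by simp, hinl _⟩)
        (by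
          rintro (i₁ | i₁) (i₂ | i₂) hne <;> simp at hne ⊢ <;> exact fun h => (hne h).elim)
        (by
          rintro _ ⟨x, hx, rfl⟩
          exact ⟨⟨by simpa using hx.1, hx.2⟩, by rintro (i | i) <;> simp⟩)
      have := hm'.preimage (H := H) Embedding.sumInr
      rw [preimage_image_inr] at this
      exact ⟨m, by simpa using hm, Sum.inr ⁻¹' A, hA.preimage Embedding.sumInr, this⟩

lemma clusterOn_small (a b : ℕ) :
    ClusterOn (copies a (K 1) ⊕g copies b (K 2)) Set.univ (a + b) := by
  refine ⟨Sum.elim (fun x => x.1) (fun x => a + x.1), Finset.range (a + b), by simp, ?_, ?_⟩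
  · rintro (⟨x, _⟩ | ⟨x, _⟩) - <;> simp
    omega
  · rintro (⟨x, i⟩ | ⟨x, i⟩) - (⟨y, j⟩ | ⟨y, j⟩) - hxy
    · simp [Subsingleton.elim i j, Fin.val_inj] at hxy ⊢
      exact hxy
    · simp; omega
    · simp; omega
    · simp [Fin.val_inj] at hxy ⊢
      exact hxy

lemma PolarOn.polarOn_withSmall {a b m k : ℕ} {S : Set W} (h : PolarOn H S m) (hk : a + b + m ≤ k) :
    PolarOn (withSmall a b H) (fullOver S) k := by
  obtain ⟨A, hA, hB⟩ := h
  refine ⟨Sum.inr '' A, hA.image Embedding.sumInr, ClusterOn.mono (ClusterOn.union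
    ((clusterOn_small a b).image Embedding.sumInl) (hB.image Embedding.sumInr) ?_ ?_) subset_rfl hk⟩
  · rintro _ ⟨x, -, rfl⟩ _ ⟨y, -, rfl⟩
    simp
  · rintro (x | x) ⟨hx, hx'⟩
    · exact Or.inl ⟨x, trivial, rfl⟩
    · exact Or.inr ⟨x, ⟨by simpa using hx, fun h => hx' ⟨x, h, rfl⟩⟩, rfl⟩

lemma SplitOn.polarOn_withSmall {a b m k : ℕ} {S : Set W} (h : SplitOn H S m) (hk : b + m ≤ k) :
    PolarOn (withSmall a b H) (fullOver S) k := by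
  obtain ⟨A, hA, hB⟩ := h
  have hB₁ : IndepOn (withSmall a b H)
      (Set.range fun i : Fin b => (.inl (.inr (i, 1)))) := by
    rintro _ ⟨i, rfl⟩ _ ⟨j, rfl⟩
    simp
  have hc₁ := clusterOn_of_indepOn hB₁ (Set.finite_range _)
  have hcard : (Set.range fun i : Fin b =>
      (.inl (.inr (i, 1)) : (Fin a × Fin 1 ⊕ Fin b × Fin 2) ⊕ W)).ncard ≤ b := by
    rw [← Set.image_univ]
    refine (Set.ncard_image_le).trans ?_
    simp [Set.ncard_univ]
  refine ⟨{x | (∃ i, x = .inl (.inl i)) ∨ (∃ i, x = .inl (.inr (i, 0))) ∨ ∃ i ∈ A, x = .inr i},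
    IndepOn.cmOn ?_, ClusterOn.mono (ClusterOn.union hc₁ (hB.image Embedding.sumInr)
    ?_ ?_) subset_rfl (Nat.le_trans (Nat.add_le_add_right hcard m) hk)⟩
  · rintro x (⟨i, rfl⟩ | ⟨i, rfl⟩ | ⟨i, hi, rfl⟩) y (⟨j, rfl⟩ | ⟨j, rfl⟩ | ⟨j, hj, rfl⟩)
    · simp [Subsingleton.elim i.2 j.2]
    · simp
    · simp
    · simp
    · simp
    · simp
    · simp
    · simp
    · simpa using hA i hi j hj
  · rintro _ ⟨x, rfl⟩ _ ⟨y, -, rfl⟩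
    simp
  · rintro ((⟨x, j⟩ | ⟨x, j⟩) | x) ⟨hx, hx'⟩
    · simp [Subsingleton.elim j 0] at hx'
    · rcases Fin.exists_fin_two.1 ⟨j, rfl⟩ with rfl | rfl
      · simp at hx'
      · exact Or.inl ⟨x, rfl⟩
    · exact Or.inr ⟨x, ⟨by simpa using hx, by simpa using hx'⟩, rfl⟩

/-- Removing a trivial component. -/
def withSmallSuccAboveLeft {a : ℕ} (b : ℕ) (H : SimpleGraph W) (i : Fin (a + 1)) :
    withSmall a b H ↪g withSmall (a + 1) b H where
  toFun := Sum.map (Sum.map (Prod.map i.succAbove id) id) id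
  inj' := Function.Injective.sumMap (Function.Injective.sumMap
    (Fin.succAbove_right_injective.prodMap Function.injective_id) Function.injective_id)
    Function.injective_id
  map_rel_iff' := by
    rintro ((x | x) | x) ((y | y) | y) <;> simp

lemma range_withSmallSuccAboveLeft {a : ℕ} (b : ℕ) (H : SimpleGraph W) (i : Fin (a + 1)) :
    Set.range (withSmallSuccAboveLeft b H i) = {.inl (.inl (i, 0))}ᶜ := by
  ext x
  simp only [Set.mem_range, Set.mem_compl_iff, Set.mem_singleton_iff]
  constructor
  · rintro ⟨((y | y) | y), rfl⟩ <;> simp [withSmallSuccAboveLeft, Prod.ext_iff, Fin.succAbove_ne]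
  · intro hx
    rcases x with (⟨x, j⟩ | x) | x
    · have : x ≠ i := fun h => hx (by simp [h, Subsingleton.elim j 0])
      obtain ⟨y, rfl⟩ := Fin.exists_succAbove_eq this
      exact ⟨.inl (.inl (y, j)), rfl⟩
    · exact ⟨.inl (.inr x), rfl⟩
    · exact ⟨.inr x, rfl⟩

/-- The vertex map of `withSmallSuccAboveRight`. -/
def succAboveRightFun (a : ℕ) {b : ℕ} (i : Fin (b + 1)) (j : Fin 2) :
    (Fin (a + 1) × Fin 1 ⊕ Fin b × Fin 2) ⊕ W → (Fin a × Fin 1 ⊕ Fin (b + 1) × Fin 2) ⊕ W :=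
  Sum.elim (Sum.elim
    (fun x => Fin.cases (.inl (.inr (i, j.rev))) (fun y => .inl (.inl (y, 0))) x.1)
    (fun x => .inl (.inr (i.succAbove x.1, x.2)))) Sum.inr

section

variable (a : ℕ) {b : ℕ} (i : Fin (b + 1)) (j : Fin 2)

@[simp] lemma succAboveRightFun_zero (x : Fin 1) :
    succAboveRightFun (W := W) a i j (.inl (.inl (0, x))) = .inl (.inr (i, j.rev)) := rfl

@[simp] lemma succAboveRightFun_succ (y : Fin a) (x : Fin 1) :
    succAboveRightFun (W := W) a i j (.inl (.inl (y.succ, x))) = .inl (.inl (y, 0)) := rfl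

@[simp] lemma succAboveRightFun_inl_inr (x : Fin b) (l : Fin 2) :
    succAboveRightFun (W := W) a i j (.inl (.inr (x, l))) = .inl (.inr (i.succAbove x, l)) := rfl

@[simp] lemma succAboveRightFun_inr (x : W) :
    succAboveRightFun a i j (.inr x) = .inr x := rfl

lemma succAboveRightFun_injective : Function.Injective (succAboveRightFun (W := W) a i j) := by
  rintro ((⟨x, x'⟩ | ⟨x, x'⟩) | x) ((⟨y, y'⟩ | ⟨y, y'⟩) | y) h
  · rw [Subsingleton.elim x' y']
    cases x using Fin.cases <;> cases y using Fin.cases <;> simp_all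
  · cases x using Fin.cases <;> simp at h
  · cases x using Fin.cases <;> simp at h
  · cases y using Fin.cases <;> simp at h
  · simpa using h
  · simp at h
  · cases y using Fin.cases <;> simp at h
  · simp at h
  · simpa using h

/-- Removing a vertex of a component with two vertices. -/
def withSmallSuccAboveRight (H : SimpleGraph W) :
    withSmall (a + 1) b H ↪g withSmall a (b + 1) H where
  toFun := succAboveRightFun a i j
  inj' := succAboveRightFun_injective a i j
  map_rel_iff' := by
    intro x y
    simp only [Function.Embedding.coeFn_mk]
    obtain ((⟨x, x'⟩ | ⟨x, x'⟩) | x) := x <;> obtain ((⟨y, y'⟩ | ⟨y, y'⟩) | y) := y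
    · rw [Subsingleton.elim x' y']
      cases x using Fin.cases <;> cases y using Fin.cases <;> simp
    · cases x using Fin.cases <;> simp
    · cases x using Fin.cases <;> simp
    · cases y using Fin.cases <;> simp
    · simp
    · simp
    · cases y using Fin.cases <;> simp
    · simp
    · simp

lemma range_withSmallSuccAboveRight (H : SimpleGraph W) :
    Set.range (withSmallSuccAboveRight a i j H) = {.inl (.inr (i, j))}ᶜ := by
  change Set.range (succAboveRightFun a i j) = _
  ext x
  simp only [Set.mem_range, Set.mem_compl_iff, Set.mem_singleton_iff]
  constructor
  · rintro ⟨((⟨y, _⟩ | ⟨y, _⟩) | y), rfl⟩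
    · cases y using Fin.cases
      · simp
        revert j
        decide
      · simp
    · simp [Fin.succAbove_ne]
    · simp
  · intro hx
    rcases x with (⟨x, l⟩ | ⟨x, l⟩) | x
    · exact ⟨.inl (.inl (x.succ, 0)), by simp [Subsingleton.elim l 0]⟩
    · by_cases h : x = i
      · subst h
        refine ⟨.inl (.inl (0, 0)), ?_⟩
        have hlj : l ≠ j := fun h => hx (by rw [h])
        have : l = j.rev := by
          clear hx
          revert l j
          decide
        simp [this]
      · obtain ⟨y, rfl⟩ := Fin.exists_succAbove_eq h
        exact ⟨.inl (.inr (y, l)), rfl⟩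
    · exact ⟨.inr x, rfl⟩

end

/-- The properties of `H` which make `p K₁ + b K₂ + H` a minimal `(∞, p + b + t - 1)`-polar
obstruction. -/
structure IsCore {V : Type*} (p t : ℕ) (H : SimpleGraph V) : Prop where
  le_split : ∀ m, SplitOn H Set.univ m → p + t ≤ m
  le_polar : ∀ m, PolarOn H Set.univ m → t ≤ m
  polar : PolarOn H Set.univ t
  split : SplitOn H Set.univ (p + t)
  remove : ∀ v, (∃ m < p + t, SplitOn H {v}ᶜ m) ∨ (∃ m < t, PolarOn H {v}ᶜ m)

lemma not_polarOn_withSmall [Nonempty W] {p b t k : ℕ}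
    (h₁ : ∀ m, SplitOn H Set.univ m → p + t ≤ m) (h₂ : ∀ m, PolarOn H Set.univ m → t ≤ m)
    (hk : p + b + t = k + 1) : ¬ PolarOn (withSmall p b H) Set.univ k := by
  intro h
  rw [← fullOver_univ] at h
  obtain ⟨m, hm, h⟩ | ⟨m, hm, h⟩ := PolarOn.of_withSmall Set.univ_nonempty h
  · have := h₁ m h
    omega
  · have := h₂ m h
    omega

lemma CographLike.withSmall (h : CographLike H) (a b : ℕ) : CographLike (withSmall a b H) :=
  ((CographLike.top.copies a).sum (CographLike.top.copies b)).sum h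

/-- To be a minimal obstruction it suffices that the removal of any one vertex makes the graph
polar. -/
lemma isMinimalObstruction_iff {V : Type u} [Finite V] {G : SimpleGraph V} {k : ℕ} :
    IsMinimalObstruction ⊤ k G ↔ CographLike G ∧ ¬ PolarOn G Set.univ k ∧
      ∀ v, PolarOn G {v}ᶜ k := by
  unfold IsMinimalObstruction
  simp only [isCograph_iff, isPolar_induce_iff]
  rw [isPolar_iff]
  constructor
  · rintro ⟨⟨h1, h2⟩, h3, h4⟩
    exact ⟨h1, h3, fun v => h4 _ (by simp)⟩
  · rintro ⟨h1, h2, h3⟩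
    refine ⟨⟨h1, ?_⟩, h2, fun S hS => ?_⟩
    · by_contra hV
      rw [not_nonempty_iff] at hV
      exact h2 ⟨∅, fun x => hV.elim x, 0, ∅, by simp, ⟨fun x => hV.elim x, fun x => hV.elim x⟩⟩
    · obtain ⟨v, hv⟩ := (Set.ne_univ_iff_exists_notMem S).1 hS
      exact (h3 v).mono (by simpa using hv) le_rfl

lemma polarOn_compl_singleton_iff {k : ℕ} {v : V} (f : H ↪g G) (hf : Set.range f = {v}ᶜ) :
    PolarOn G {v}ᶜ k ↔ PolarOn H Set.univ k := by
  constructor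
  · intro h
    refine (h.preimage f).mono (fun x _ => ?_) le_rfl
    rw [← hf]
    simp
  · intro h
    simpa [hf] using h.image f

lemma IsCore.isMinimalObstruction {W : Type} [Finite W] [Nonempty W] {H : SimpleGraph W}
    {p b t k : ℕ} (h : IsCore p t H) (hH : CographLike H) (hp : 1 ≤ p) (hk : p + b + t = k + 1) :
    IsMinimalObstruction ⊤ k (PolarCograph.withSmall p b H) := by
  rw [isMinimalObstruction_iff]
  refine ⟨hH.withSmall p b, not_polarOn_withSmall h.le_split h.le_polar hk, ?_⟩
  rintro ((⟨i, j⟩ | ⟨i, j⟩) | v)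
  · obtain ⟨p, rfl⟩ := Nat.exists_eq_add_of_le' hp
    rw [Subsingleton.elim j 0, polarOn_compl_singleton_iff _ (range_withSmallSuccAboveLeft b H i),
      ← fullOver_univ]
    exact h.polar.polarOn_withSmall (by omega)
  · obtain ⟨b, rfl⟩ := Nat.exists_eq_add_of_le' i.pos
    rw [polarOn_compl_singleton_iff _ (range_withSmallSuccAboveRight p i j H),
      ← fullOver_univ]
    exact h.split.polarOn_withSmall (by omega)
  · rw [← fullOver_compl_singleton]
    obtain ⟨m, hm, h⟩ | ⟨m, hm, h⟩ := h.remove v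
    · exact h.polarOn_withSmall (by omega)
    · exact h.polarOn_withSmall (by omega)

lemma isCore_of_withSmall [Nontrivial W] {p b t k : ℕ} (hp : 1 ≤ p) (hb : 1 ≤ b)
    (hk : p + b + t = k + 1) (h : ¬ PolarOn (PolarCograph.withSmall p b H) Set.univ k)
    (h' : ∀ v, PolarOn (PolarCograph.withSmall p b H) {v}ᶜ k) : IsCore p t H := by
  have h₁ : ∀ m, SplitOn H Set.univ m → p + t ≤ m := by
    intro m hm
    by_contra hlt
    rw [← fullOver_univ] at h
    exact h (hm.polarOn_withSmall (by omega))
  have h₂ : ∀ m, PolarOn H Set.univ m → t ≤ m := by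
    intro m hm
    by_contra hlt
    rw [← fullOver_univ] at h
    exact h (hm.polarOn_withSmall (by omega))
  refine ⟨h₁, h₂, ?_, ?_, ?_⟩
  · obtain ⟨p, rfl⟩ := Nat.exists_eq_add_of_le' hp
    have h3 := h' (.inl (.inl (0, 0)))
    rw [polarOn_compl_singleton_iff _ (range_withSmallSuccAboveLeft b H 0),
      ← fullOver_univ] at h3
    obtain ⟨m, hm, h3⟩ | ⟨m, hm, h3⟩ := h3.of_withSmall Set.univ_nonempty
    · have := h₁ m h3
      omega
    · exact h3.mono subset_rfl (by omega)
  · obtain ⟨b, rfl⟩ := Nat.exists_eq_add_of_le' hb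
    have h3 := h' (.inl (.inr (0, 0)))
    rw [polarOn_compl_singleton_iff _ (range_withSmallSuccAboveRight p 0 0 H),
      ← fullOver_univ] at h3
    obtain ⟨m, hm, h3⟩ | ⟨m, hm, h3⟩ := h3.of_withSmall Set.univ_nonempty
    · exact h3.mono subset_rfl (by omega)
    · have := h₂ m h3
      omega
  · intro v
    have h3 := h' (.inr v)
    rw [← fullOver_compl_singleton] at h3
    obtain ⟨w, hw⟩ := exists_ne v
    obtain ⟨m, hm, h3⟩ | ⟨m, hm, h3⟩ := h3.of_withSmall ⟨w, by simpa using hw⟩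
    · exact Or.inl ⟨m, by omega, h3⟩
    · exact Or.inr ⟨m, by omega, h3⟩

end WithSmall

end PolarCograph

namespace PolarCograph

section Components

variable {V W : Type*} {G : SimpleGraph V} {H : SimpleGraph W}

/-- A true twin of a vertex outside the complete multipartite part can be added to the cluster
part. -/
lemma ClusterOn.polarOn_of_twin {k : ℕ} {A : Set V} {x y : V} (hA : CMOn G A)
    (hB : ClusterOn G ({x}ᶜ \ A) k) (hxy : G.Adj x y)
    (htw : ∀ z, z ≠ x → z ≠ y → (G.Adj x z ↔ G.Adj y z)) (hy : y ∉ A) :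
    PolarOn G Set.univ k := by
  classical
  obtain ⟨c, s, hs, hc⟩ := hB
  have hyB : y ∈ ({x}ᶜ \ A : Set V) := ⟨hxy.ne', hy⟩
  have hmem : ∀ z ∈ Set.univ \ (A \ {x}), z ≠ x → z ∈ ({x}ᶜ \ A : Set V) :=
    fun z hz hzx => ⟨hzx, fun h => hz.2 ⟨h, hzx⟩⟩
  have hx : ∀ z ∈ ({x}ᶜ \ A : Set V), G.Adj x z ↔ c y = c z := by
    intro z hz
    by_cases hzy : z = y
    · simp [hzy, hxy]
    · rw [htw z hz.1 hzy, hc.adj_iff y hyB z hz (Ne.symm hzy)]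
  refine ⟨A \ {x}, hA.mono Set.sdiff_subset, Function.update c x (c y), s, hs, ?_, ?_⟩
  · intro z hz
    by_cases hzx : z = x
    · simpa [hzx] using hc.mem y hyB
    · simpa [hzx] using hc.mem z (hmem z hz hzx)
  · intro z hz w hw hzw
    by_cases hzx : z = x
    · subst hzx
      simpa [Ne.symm hzw] using hx w (hmem w hw (Ne.symm hzw))
    · by_cases hwx : w = x
      · subst hwx
        simpa [hzw, G.adj_comm, eq_comm] using hx z (hmem z hz hzw)
      · simpa [hzx, hwx] using hc.adj_iff z (hmem z hz hzx) w (hmem w hw hwx) hzw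

lemma ClusterOn.adj_of_reachable {B : Set V} {k : ℕ} (hB : ClusterOn G B k)
    {D : G.ConnectedComponent} (hD : D.supp ⊆ B) {x y : V} (hx : x ∈ D.supp) (hy : y ∈ D.supp)
    (hxy : x ≠ y) : G.Adj x y := by
  obtain ⟨w⟩ : G.Reachable x y := ConnectedComponent.exact (hx.trans hy.symm)
  induction w with
  | nil => exact absurd rfl hxy
  | @cons x u y h w ih =>
    have hu : u ∈ D.supp := D.mem_supp_of_adj_mem_supp hx h
    by_cases huy : u = y
    · exact huy ▸ h
    · exact hB.adj_trans (hD hx) (hD hu) (hD hy) h (ih hu hy huy) hxy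

lemma mem_supp_iff_of_adj {D : G.ConnectedComponent} {x y : V} (h : G.Adj x y) :
    x ∈ D.supp ↔ y ∈ D.supp :=
  ⟨fun hx => D.mem_supp_of_adj_mem_supp hx h, fun hy => D.mem_supp_of_adj_mem_supp hy h.symm⟩

/-- A graph whose components other than `C` are known is a `withSmall`. -/
lemma nonempty_iso_withSmall (C : G.ConnectedComponent) {p b : ℕ}
    {T N : Set G.ConnectedComponent} (eT : Fin p ≃ T) (eN : Fin b ≃ N)
    (hT : ∀ D ∈ T, ∃ v, D.supp = {v}) (hN : ∀ D ∈ N, ∃ x y, G.Adj x y ∧ D.supp = {x, y})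
    (hTN : Disjoint T N) (hCT : C ∉ T) (hCN : C ∉ N) (hall : ∀ D, D ∈ T ∨ D ∈ N ∨ D = C) :
    Nonempty (withSmall p b C.toSimpleGraph ≃g G) := by
  choose tv htv using fun i => hT _ (eT i).2
  choose x y hxy hsupp using fun i => hN _ (eN i).2
  let φ : (Fin p × Fin 1 ⊕ Fin b × Fin 2) ⊕ C.supp → V :=
    Sum.elim (Sum.elim (fun i => tv i.1) (fun i => ![x i.1, y i.1] i.2)) Subtype.val
  let κ : (Fin p × Fin 1 ⊕ Fin b × Fin 2) ⊕ C.supp → G.ConnectedComponent :=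
    Sum.elim (Sum.elim (fun i => eT i.1) (fun i => eN i.1)) (fun _ => C)
  have hmem : ∀ w, φ w ∈ (κ w).supp := by
    rintro ((⟨i, j⟩ | ⟨i, j⟩) | w)
    · simp [φ, κ, htv i]
    · rcases Fin.exists_fin_two.1 ⟨j, rfl⟩ with rfl | rfl <;> simp only [φ, κ, Sum.elim_inl,
        Sum.elim_inr, hsupp i] <;> simp
    · exact w.2
  have hκ : ∀ w w', (κ w = κ w' → G.Adj (φ w) (φ w') → False) → ¬ G.Adj (φ w) (φ w') := by
    intro w w' h hadj
    exact h (ConnectedComponent.eq_of_common_vertex (v := φ w') ((mem_supp_iff_of_adj hadj).1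
      (hmem w)) (hmem w')) hadj
  have hTN' : ∀ i j, (eT i : G.ConnectedComponent) ≠ eN j := fun i j h =>
    Set.disjoint_left.1 hTN (eT i).2 (h ▸ (eN j).2)
  have hTC : ∀ i, (eT i : G.ConnectedComponent) ≠ C := fun i h => hCT (h ▸ (eT i).2)
  have hNC : ∀ i, (eN i : G.ConnectedComponent) ≠ C := fun i h => hCN (h ▸ (eN i).2)
  have hadj : ∀ w w', G.Adj (φ w) (φ w') ↔ (withSmall p b C.toSimpleGraph).Adj w w' := by
    rintro ((⟨i, j⟩ | ⟨i, j⟩) | w) ((⟨i', j'⟩ | ⟨i', j'⟩) | w')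
    · rw [Subsingleton.elim j' j]
      have : ¬ G.Adj (φ (.inl (.inl (i, j)))) (φ (.inl (.inl (i', j)))) := hκ _ _ fun h h' => by
        simp only [κ, Sum.elim_inl, Subtype.coe_inj, eT.apply_eq_iff_eq] at h
        subst h
        exact G.loopless.irrefl _ h'
      simpa using this
    · have := hκ (.inl (.inl (i, j))) (.inl (.inr (i', j'))) fun h _ => hTN' _ _ h
      simpa using this
    · have := hκ (.inl (.inl (i, j))) (.inr w') fun h _ => hTC _ h
      simpa using this
    · have := hκ (.inl (.inr (i, j))) (.inl (.inl (i', j'))) fun h _ => hTN' _ _ h.symm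
      simpa using this
    · by_cases hii : i = i'
      · subst hii
        have := hxy i
        rcases Fin.exists_fin_two.1 ⟨j, rfl⟩ with rfl | rfl <;>
        rcases Fin.exists_fin_two.1 ⟨j', rfl⟩ with rfl | rfl <;>
        simp [φ, this, this.symm]
      · have := hκ (.inl (.inr (i, j))) (.inl (.inr (i', j'))) fun h _ => hii (by
          simpa only [κ, Sum.elim_inl, Sum.elim_inr, Subtype.coe_inj, eN.apply_eq_iff_eq] using h)
        simpa [hii] using this
    · have := hκ (.inl (.inr (i, j))) (.inr w') fun h _ => hNC _ h
      simpa using this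
    · have := hκ (.inr w) (.inl (.inl (i', j'))) fun h _ => hTC _ h.symm
      simpa using this
    · have := hκ (.inr w) (.inl (.inr (i', j'))) fun h _ => hNC _ h.symm
      simpa using this
    · simp [φ, ConnectedComponent.toSimpleGraph]
  have hinj : Function.Injective φ := by
    intro w w' h
    have hk : κ w = κ w' := ConnectedComponent.eq_of_common_vertex (hmem w) (h ▸ hmem w')
    revert h hk
    obtain ((⟨i, j⟩ | ⟨i, j⟩) | w) := w <;> obtain ((⟨i', j'⟩ | ⟨i', j'⟩) | w') := w' <;>
      intro h hk <;> simp only [κ, Sum.elim_inl, Sum.elim_inr] at hk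
    · rw [Subtype.coe_inj, eT.apply_eq_iff_eq] at hk
      rw [hk, Subsingleton.elim j j']
    · exact absurd hk (hTN' _ _)
    · exact absurd hk (hTC _)
    · exact absurd hk.symm (hTN' _ _)
    · rw [Subtype.coe_inj, eN.apply_eq_iff_eq] at hk
      subst hk
      have := (hxy i).ne
      rcases Fin.exists_fin_two.1 ⟨j, rfl⟩ with rfl | rfl <;>
        rcases Fin.exists_fin_two.1 ⟨j', rfl⟩ with rfl | rfl <;>
        simp [φ, this, this.symm] at h ⊢
    · exact absurd hk (hNC _)
    · exact absurd hk.symm (hTC _)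
    · exact absurd hk.symm (hNC _)
    · exact congrArg Sum.inr (Subtype.ext h)
  have hsurj : Function.Surjective φ := by
    intro v
    have hv : v ∈ (G.connectedComponentMk v).supp := rfl
    rcases hall (G.connectedComponentMk v) with h | h | h
    · obtain ⟨i, hi⟩ := eT.surjective ⟨_, h⟩
      have h1 := htv i
      rw [hi] at h1
      exact ⟨.inl (.inl (i, 0)), ((h1 ▸ hv : v ∈ ({tv i} : Set V)) : v = tv i).symm⟩
    · obtain ⟨i, hi⟩ := eN.surjective ⟨_, h⟩
      have h1 := hsupp i
      rw [hi] at h1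
      rcases (h1 ▸ hv : v ∈ ({x i, y i} : Set V)) with h2 | h2
      · exact ⟨.inl (.inr (i, 0)), h2.symm⟩
      · exact ⟨.inl (.inr (i, 1)), h2.symm⟩
    · exact ⟨.inr ⟨v, h ▸ hv⟩, rfl⟩
  exact ⟨⟨Equiv.ofBijective φ ⟨hinj, hsurj⟩, @hadj⟩⟩

lemma HasType.exists_iso_withSmall [Finite V] {p b k : ℕ} (hp : 1 ≤ p)
    (hno : ¬ PolarOn G Set.univ k) (hrem : ∀ v, PolarOn G {v}ᶜ k)
    (htype : HasType (p + b + 1) p G) : ∃ C : G.ConnectedComponent, C.supp.Nontrivial ∧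
      Nonempty (withSmall p b C.toSimpleGraph ≃g G) := by
  obtain ⟨hc, hi⟩ := htype
  set T := {C : G.ConnectedComponent | ∃ v, C.supp = {v}} with hT
  have hTcard : T.ncard = p := by simp [Set.ncard, hi]
  rw [ENat.card_eq_coe_natCard] at hc
  have hc : Nat.card G.ConnectedComponent = p + b + 1 := by exact_mod_cast hc
  obtain ⟨C₀, v, hv⟩ : T.Nonempty := Set.nonempty_of_ncard_ne_zero (by omega)
  have hviso : ∀ z, ¬ G.Adj v z := by
    intro z hz
    have h1 : v ∈ C₀.supp := hv ▸ rfl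
    rw [mem_supp_iff_of_adj hz, hv] at h1
    exact hz.ne' h1
  obtain ⟨A, hA, hB⟩ := hrem v
  have hnind : ¬ IndepOn G (A \ {v}) := by
    intro hind
    refine hno ⟨insert v A, ?_, hB.mono ?_ le_rfl⟩
    · refine IndepOn.cmOn fun x hx y hy hxy => ?_
      refine hind x ⟨hx.resolve_left ?_, ?_⟩ y ⟨hy.resolve_left ?_, ?_⟩ hxy
      any_goals rintro rfl
      any_goals exact hviso _ hxy
      any_goals exact hviso _ hxy.symm
    · intro x hx
      exact ⟨fun h => hx.2 (Or.inl h), fun h => hx.2 (Or.inr h)⟩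
  simp only [IndepOn, not_forall, not_not] at hnind
  obtain ⟨x₀, hx₀, y₀, hy₀, hxy₀⟩ := hnind
  set C := G.connectedComponentMk x₀
  have hx₀C : x₀ ∈ C.supp := rfl
  have hy₀C : y₀ ∈ C.supp := (mem_supp_iff_of_adj hxy₀).1 hx₀C
  have hout : ∀ z, z ∉ C.supp → z ∉ A := fun z hz hzA =>
    hA x₀ hx₀.1 z hzA y₀ hy₀.1 (fun h => hz ((mem_supp_iff_of_adj h).1 hx₀C))
      (fun h => hz ((mem_supp_iff_of_adj h).2 hy₀C)) hxy₀
  have hCnt : C.supp.Nontrivial := ⟨x₀, hx₀C, y₀, hy₀C, hxy₀.ne⟩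
  refine ⟨C, hCnt, ?_⟩
  have hCT : C ∉ T := by
    rintro ⟨w, hw⟩
    exact Set.not_nontrivial_singleton (hw ▸ hCnt)
  have hclique : ∀ D, D ∉ T → D ≠ C → ∀ x ∈ D.supp, ∀ y ∈ D.supp, x ≠ y → G.Adj x y := by
    intro D hDT hDC x hx y hy hxy
    refine hB.adj_of_reachable (D := D) (fun z hz => ⟨?_, hout z fun h => hDC
      (ConnectedComponent.eq_of_common_vertex hz h)⟩) hx hy hxy
    rintro rfl
    have : D = C₀ := ConnectedComponent.eq_of_common_vertex hz (hv ▸ rfl)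
    exact hDT (this ▸ ⟨z, hv⟩)
  have hK2 : ∀ D, D ∉ T → D ≠ C → ∃ x y, G.Adj x y ∧ D.supp = {x, y} := by
    intro D hDT hDC
    have hcl := hclique D hDT hDC
    obtain ⟨x, hx⟩ := D.nonempty_supp
    obtain ⟨x', hx', hne⟩ : ∃ x' ∈ D.supp, x' ≠ x := by
      by_contra! hcon
      exact hDT ⟨x, Set.eq_singleton_iff_unique_mem.2 ⟨hx, hcon⟩⟩
    obtain ⟨A', hA', hB'⟩ := hrem x
    have hsub : ∀ y ∈ D.supp, y ≠ x → y ∈ A' := by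
      intro y hy hyx
      by_contra hyA
      refine hno (hB'.polarOn_of_twin hA' (hcl x hx y hy hyx.symm) (fun z hzx hzy => ?_) hyA)
      by_cases hz : z ∈ D.supp
      · simp [hcl x hx z hz hzx.symm, hcl y hy z hz hzy.symm]
      · exact iff_of_false (fun h => hz ((mem_supp_iff_of_adj h).1 hx))
          (fun h => hz ((mem_supp_iff_of_adj h).1 hy))
    by_cases hind : IndepOn G (A' \ {x})
    · refine ⟨x, x', hcl x hx x' hx' hne.symm, Set.Subset.antisymm (fun z hz => ?_) ?_⟩
      · by_contra hcon
        simp only [Set.mem_insert_iff, Set.mem_singleton_iff, not_or] at hcon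
        exact hind z ⟨hsub z hz hcon.1, hcon.1⟩ x' ⟨hsub x' hx' hne, hne⟩
          (hcl z hz x' hx' hcon.2)
      · rintro z (rfl | rfl)
        · exact hx
        · exact hx'
    · exfalso
      simp only [IndepOn, not_forall, not_not] at hind
      obtain ⟨x₁, hx₁, y₁, hy₁, hxy₁⟩ := hind
      have hx₁D : x₁ ∈ D.supp := by
        by_contra h
        refine hA' x₁ hx₁.1 x' (hsub x' hx' hne) y₁ hy₁.1
          (fun h' => h ((mem_supp_iff_of_adj h').2 hx')) (fun h' => h ?_) hxy₁
        rwa [mem_supp_iff_of_adj hxy₁, ← mem_supp_iff_of_adj h']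
      have hAD : ∀ z ∈ A', z ∈ D.supp := by
        intro z hz
        by_contra h
        refine hA' x₁ hx₁.1 z hz y₁ hy₁.1
          (fun h' => h ((mem_supp_iff_of_adj h').1 hx₁D)) (fun h' => h ?_) hxy₁
        rwa [mem_supp_iff_of_adj h', ← mem_supp_iff_of_adj hxy₁]
      have hAD' : insert x A' ⊆ D.supp := Set.insert_subset hx hAD
      refine hno ⟨insert x A', cmOn_of_clique fun y hy z hz =>
        hcl y (hAD' hy) z (hAD' hz), hB'.mono ?_ le_rfl⟩
      intro z hz
      exact ⟨fun h => hz.2 (Or.inl h), fun h => hz.2 (Or.inr h)⟩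
  set N := (insert C T)ᶜ with hN
  have hNcard : N.ncard = b := by
    have h1 := Set.ncard_add_ncard_compl (insert C T)
    rw [Set.ncard_insert_of_notMem hCT, hTcard, hc] at h1
    rw [hN]
    omega
  refine nonempty_iso_withSmall C (T := T) (N := N)
    (Finite.equivFinOfCardEq (by rwa [Nat.card_coe_set_eq])).symm
    (Finite.equivFinOfCardEq (by rwa [Nat.card_coe_set_eq])).symm (fun D hD => hD)
    (fun D hD => hK2 D (fun h => hD (Or.inr h)) (fun h => hD (Or.inl h))) ?_ hCT
    (fun h => h (Or.inl rfl)) ?_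
  · exact Set.disjoint_left.2 fun D hD h => h (Or.inr hD)
  · intro D
    by_cases h1 : D ∈ T
    · exact Or.inl h1
    by_cases h2 : D = C
    · exact Or.inr (Or.inr h2)
    · exact Or.inr (Or.inl (by rintro (h | h); exacts [h2 h, h1 h]))

lemma card_connectedComponent_of_map {ι : Type*} (φ : V → ι) (hs : Function.Surjective φ)
    (hφ : ∀ x y, G.Reachable x y ↔ φ x = φ y) :
    ENat.card G.ConnectedComponent = ENat.card ι ∧
      {C : G.ConnectedComponent | ∃ v, C.supp = {v}}.encard =
        {i | ∃ v, φ ⁻¹' {i} = {v}}.encard := by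
  let f : G.ConnectedComponent → ι :=
    ConnectedComponent.lift φ fun v w p _ => (hφ v w).1 p.reachable
  have hf : ∀ v, f (G.connectedComponentMk v) = φ v := fun v => rfl
  have hbij : Function.Bijective f := by
    constructor
    · intro C D
      induction C using ConnectedComponent.ind with | _ x
      induction D using ConnectedComponent.ind with | _ y
      rw [hf, hf, ← hφ]
      exact fun h => ConnectedComponent.sound h
    · intro i
      obtain ⟨v, rfl⟩ := hs i
      exact ⟨_, hf v⟩
  refine ⟨ENat.card_congr (Equiv.ofBijective f hbij), ?_⟩
  rw [← hbij.1.encard_image]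
  congr 1
  have hsupp : ∀ C : G.ConnectedComponent, C.supp = φ ⁻¹' {f C} := by
    intro C
    ext v
    rw [ConnectedComponent.mem_supp_iff, ← hbij.1.eq_iff, hf]
    rfl
  ext i
  obtain ⟨C, rfl⟩ := hbij.2 i
  rw [hbij.1.mem_set_image]
  simp only [Set.mem_ofPred_eq, hsupp]

lemma hasType_of_iso_withSmall [Nontrivial W] (hH : H.Preconnected) {p b : ℕ}
    (e : G ≃g withSmall p b H) : HasType (p + b + 1) p G := by
  let ψ : (Fin p × Fin 1 ⊕ Fin b × Fin 2) ⊕ W → (Fin p ⊕ Fin b) ⊕ Unit :=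
    Sum.map (Sum.map Prod.fst Prod.fst) fun _ => ()
  have hψ : ∀ x y, (withSmall p b H).Reachable x y ↔ ψ x = ψ y := by
    intro x y
    constructor
    · rintro ⟨w⟩
      induction w with
      | nil => rfl
      | @cons x u _ h _ ih =>
        rw [← ih]
        obtain ((x | x) | x) := x <;> obtain ((u | u) | u) := u <;> simp at h <;> simp [ψ, h]
    · intro h
      obtain ((⟨i, j⟩ | ⟨i, j⟩) | x) := x <;> obtain ((⟨i', j'⟩ | ⟨i', j'⟩) | y) := y <;>
        simp [ψ] at h
      · rw [h, Subsingleton.elim j j']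
      · subst h
        by_cases hj : j = j'
        · rw [hj]
        · exact Adj.reachable (by simpa using hj)
      · exact (hH x y).map (Embedding.sumInr (G := copies p (K 1) ⊕g copies b (K 2))).toHom
  have hsurj : Function.Surjective ψ := by
    refine Function.Surjective.sumMap (Function.Surjective.sumMap ?_ ?_) ?_
    · exact fun i => ⟨(i, 0), rfl⟩
    · exact fun i => ⟨(i, 0), rfl⟩
    · exact fun _ => ⟨Classical.arbitrary W, rfl⟩
  have hfib : {i | ∃ v, (ψ ∘ e) ⁻¹' {i} = {v}} = Set.range fun i : Fin p => .inl (.inl i) := by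
    have h2 : ∀ (i) (x y : (Fin p × Fin 1 ⊕ Fin b × Fin 2) ⊕ W), x ≠ y → ψ x = i → ψ y = i →
        ¬ ∃ v, (ψ ∘ e) ⁻¹' {i} = {v} := by
      rintro i x y hxy hx hy ⟨v, hv⟩
      have h3 : e.symm x ∈ (ψ ∘ e) ⁻¹' {i} := by simpa using hx
      have h4 : e.symm y ∈ (ψ ∘ e) ⁻¹' {i} := by simpa using hy
      rw [hv] at h3 h4
      exact hxy (e.symm.injective (h3.trans h4.symm))
    ext ((i | i) | i)
    · refine iff_of_true ⟨e.symm (.inl (.inl (i, 0))), ?_⟩ ⟨i, rfl⟩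
      ext x
      obtain ⟨x, rfl⟩ := e.symm.surjective x
      rw [Set.mem_singleton_iff, e.symm.injective.eq_iff]
      obtain ((⟨i', j'⟩ | x) | x) := x
      · simp [ψ, Subsingleton.elim j' 0]
      · simp [ψ]
      · simp [ψ]
    · refine iff_of_false (h2 _ (.inl (.inr (i, 0))) (.inl (.inr (i, 1))) (by simp) rfl rfl) ?_
      simp
    · obtain ⟨x, y, hxy⟩ := exists_pair_ne W
      refine iff_of_false (h2 _ (.inr x) (.inr y) (by simpa) rfl rfl) ?_
      simp
  obtain ⟨h1, h2⟩ := card_connectedComponent_of_map (ψ ∘ e) (hsurj.comp e.surjective)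
    (fun x y => by rw [← e.reachable_iff, hψ]; rfl)
  refine ⟨?_, ?_⟩
  · rw [h1, ENat.card_eq_coe_natCard]
    simp [Nat.card_eq_fintype_card]
  · rw [h2, hfib, ← Set.image_univ, Function.Injective.encard_image]
    · simp [Set.encard_univ]
    · intro i j h
      simpa using h

end Components

end PolarCograph

namespace PolarCograph

section Cores

variable {V W : Type*} {G : SimpleGraph V} {H : SimpleGraph W}

@[simp] lemma join_adj_inl_inl {x y : V} : (join G H).Adj (.inl x) (.inl y) ↔ G.Adj x y := by
  simp [join]

@[simp] lemma join_adj_inr_inr {x y : W} : (join G H).Adj (.inr x) (.inr y) ↔ H.Adj x y := by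
  simp [join]

@[simp] lemma join_adj_inl_inr {x : V} {y : W} : (join G H).Adj (.inl x) (.inr y) := by
  simp [join]

@[simp] lemma join_adj_inr_inl {x : V} {y : W} : (join G H).Adj (.inr y) (.inl x) := by
  simp [join]

/-- The embedding of the right side into a join. -/
def joinInr (G : SimpleGraph V) (H : SimpleGraph W) : H ↪g join G H :=
  ⟨⟨Sum.inr, Sum.inr_injective⟩, join_adj_inr_inr⟩

lemma preconnected_join [Nonempty V] [Nonempty W] : (join G H).Preconnected := by
  have h : ∀ (x : V) (y : W), (join G H).Reachable (.inl x) (.inr y) := fun x y =>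
    join_adj_inl_inr.reachable
  rintro (x | x) (y | y)
  · exact (h x (Classical.arbitrary W)).trans (h y _).symm
  · exact h x y
  · exact (h y x).symm
  · exact (h (Classical.arbitrary V) x).symm.trans (h _ y)

lemma completeBipartiteGraph_eq_join : completeBipartiteGraph V W = join ⊥ ⊥ := by
  ext (x | x) (y | y) <;> simp

lemma ClusterOn.one_le {B : Set V} {m : ℕ} (h : ClusterOn G B m) {x : V} (hx : x ∈ B) : 1 ≤ m := by
  simpa using h.card_le (ι := Unit) (fun _ => x) (fun _ => hx) (fun i j hij => (hij rfl).elim)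

lemma ClusterOn.two_le {B : Set V} {m : ℕ} (h : ClusterOn G B m) {x y : V} (hx : x ∈ B)
    (hy : y ∈ B) (hxy : ¬ G.Adj x y) (hne : x ≠ y) : 2 ≤ m := by
  simpa using h.card_le (ι := Bool) (fun i => bif i then x else y) (by simp [hx, hy])
    (by simp [hxy, hne, hne.symm, G.adj_comm y x])

lemma IsClusterColoring.clusterOn {B : Set V} {c : V → ℕ} {s : Finset ℕ}
    (h : IsClusterColoring G B c s) : ClusterOn G B s.card :=
  ⟨c, s, le_rfl, h⟩

lemma ClusterOn.erase {B B' : Set V} {c : V → ℕ} {s : Finset ℕ} {n : ℕ}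
    (h : IsClusterColoring G B c s) (hn : n ∈ s) (hB : B' ⊆ B) (hc : ∀ x ∈ B', c x ≠ n) :
    ClusterOn G B' (s.card - 1) :=
  ⟨c, s.erase n, by rw [Finset.card_erase_of_mem hn],
    fun x hx => Finset.mem_erase.2 ⟨hc x hx, h.mem x (hB hx)⟩, (h.mono hB).adj_iff⟩

lemma clusterOn_range {ι : Type*} [Fintype ι] {f : ι → V} (hf : ∀ i j, ¬ G.Adj (f i) (f j)) :
    ClusterOn G (Set.range f) (Fintype.card ι) := by
  refine (clusterOn_of_indepOn (B := Set.range f) ?_ (Set.finite_range f)).mono subset_rfl ?_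
  · rintro _ ⟨i, rfl⟩ _ ⟨j, rfl⟩
    exact hf i j
  · rw [← Set.image_univ]
    exact (Set.ncard_image_le).trans (by simp [Set.ncard_univ])

lemma isCore_zero {p : ℕ} (hp : 1 ≤ p) :
    IsCore p 0 (completeBipartiteGraph (Fin p) (Fin p)) := by
  have hl : IndepOn (completeBipartiteGraph (Fin p) (Fin p)) (Set.range Sum.inl) := by
    rintro _ ⟨i, rfl⟩ _ ⟨j, rfl⟩
    simp
  have hr : IndepOn (completeBipartiteGraph (Fin p) (Fin p)) (Set.range Sum.inr) := by
    rintro _ ⟨i, rfl⟩ _ ⟨j, rfl⟩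
    simp
  have hrem : ∀ (f : Fin p → Fin p ⊕ Fin p) (i : Fin p),
      IndepOn (completeBipartiteGraph (Fin p) (Fin p)) (Set.range f) →
      ClusterOn (completeBipartiteGraph (Fin p) (Fin p)) (f '' {i}ᶜ) (p - 1) := by
    intro f i hf
    refine (clusterOn_of_indepOn (hf.mono (Set.image_subset_range f {i}ᶜ))
      (Set.toFinite _)).mono subset_rfl ?_
    refine (Set.ncard_image_le (Set.toFinite _)).trans ?_
    rw [Set.ncard_compl]
    simp
  refine ⟨?_, by simp, ⟨Set.univ, ?_, clusterOn_empty (by simp)⟩, ⟨Set.range Sum.inl, hl, ?_⟩, ?_⟩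
  · rintro m ⟨A, hA, hB⟩
    by_cases h : ∃ i, .inl i ∈ A
    · obtain ⟨i, hi⟩ := h
      simpa using hB.card_le (ι := Fin p) Sum.inr
        (fun j => ⟨trivial, fun hj => hA _ hi _ hj (by simp)⟩) (by simp)
    · push Not at h
      simpa using hB.card_le (ι := Fin p) Sum.inl (fun j => ⟨trivial, h j⟩) (by simp)
  · rintro (x | x) - (y | y) - (z | z) - <;> simp
  · refine (clusterOn_range (f := (Sum.inr : Fin p → Fin p ⊕ Fin p)) (by simp)).mono ?_ (by simp)
    rintro (x | x) <;> simp
  · rintro (i | i) <;> refine Or.inl ⟨p - 1, by omega, ?_⟩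
    · refine ⟨_, hr, (hrem _ i hl).mono ?_ le_rfl⟩
      rintro (x | x) <;> simp
    · refine ⟨_, hl, (hrem _ i hr).mono ?_ le_rfl⟩
      rintro (x | x) <;> simp

lemma isCore_one {p : ℕ} (hp : 1 ≤ p) :
    IsCore p 1 (join (K 2)ᶜ (K 2 ⊕g copies p (K 1))) := by
  have : NeZero p := ⟨by omega⟩
  have hcol : IsClusterColoring (K 2 ⊕g copies p (K 1)) Set.univ
      (Sum.elim (fun _ => 0) (fun x => x.1 + 1)) (Finset.range (p + 1)) := by
    constructor
    · rintro (x | x) - <;> simp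
    · rintro (x | ⟨x, i⟩) - (y | ⟨y, j⟩) - hxy
      · simpa using hxy
      · simp
      · simp
      · simp [Subsingleton.elim i j, Fin.val_inj] at hxy ⊢
        exact hxy
  have hl : IndepOn (join (K 2)ᶜ (K 2 ⊕g copies p (K 1))) (Set.range Sum.inl) := by
    rintro _ ⟨i, rfl⟩ _ ⟨j, rfl⟩
    simp
  refine ⟨?_, ?_, ?_, ?_, ?_⟩
  · rintro m ⟨A, hA, hB⟩
    by_cases h : ∃ i, .inl i ∈ A
    · obtain ⟨i, hi⟩ := h
      have := hB.card_le (ι := Fin p ⊕ Unit)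
        (Sum.elim (fun i => .inr (.inr (i, 0))) (fun _ => .inr (.inl 0)))
        (fun j => ⟨trivial, fun hj => hA _ hi _ hj (by rcases j with j | j <;> simp)⟩) (by simp)
      simpa using this
    · push Not at h
      obtain ⟨j, hj⟩ : ∃ j, .inr (.inl j) ∉ A := by
        by_contra! hcon
        exact hA _ (hcon 0) _ (hcon 1) (by simp)
      have := hB.adj_trans (x := .inl 0) (y := .inr (.inl j)) (z := .inl 1)
        ⟨trivial, h 0⟩ ⟨trivial, hj⟩ ⟨trivial, h 1⟩ (by simp) (by simp) (by simp)
      simp at this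
  · rintro m ⟨A, hA, hB⟩
    obtain ⟨x, hx⟩ : ∃ x, x ∉ A := by
      by_contra! hcon
      have := hA _ (hcon (.inr (.inl 0))) _ (hcon (.inr (.inr (0, 0)))) _
        (hcon (.inr (.inl 1)))
      simp at this
    exact hB.one_le ⟨trivial, hx⟩
  · refine ⟨(Set.range fun i => .inr (.inl i))ᶜ, ?_,
      ClusterOn.mono (clusterOn_of_clique (B := Set.range fun i => .inr (.inl i)) ?_)
        (by simp) le_rfl⟩
    · rintro (x | x | ⟨x, i⟩) hx (y | y | ⟨y, j⟩) hy (z | z | ⟨z, l⟩) hz <;> simp at hx hy hz ⊢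
      rw [Subsingleton.elim i l]
      simp
    · rintro _ ⟨x, rfl⟩ _ ⟨y, rfl⟩ hxy
      simpa using hxy
  · refine ⟨_, hl, ClusterOn.mono (hcol.clusterOn.image (joinInr _ _))
      ?_ (by simp)⟩
    rintro (x | x)
    · simp
    · exact fun _ => ⟨x, trivial, rfl⟩
  · rintro (j | j | ⟨i, j⟩)
    · refine Or.inl ⟨1, by omega, (Set.range fun i => .inr (.inr i)) ∪ {.inr (.inl 0)}, ?_,
        ClusterOn.mono (clusterOn_of_clique (B := {.inl j.rev, .inr (.inl 1)}) ?_) ?_ le_rfl⟩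
      · rintro _ (⟨x, rfl⟩ | rfl) _ (⟨y, rfl⟩ | rfl) <;> simp
        rw [Subsingleton.elim x.2 y.2]
        simp
      · rintro _ (rfl | rfl) _ (rfl | rfl) <;> simp
      · rintro (x | x | x) <;> simp
        · revert x j
          decide
        · omega
    · refine Or.inr ⟨0, by omega, {.inr (.inl j)}ᶜ, ?_, clusterOn_empty (by simp)⟩
      rintro (x | x | ⟨x, i⟩) hx (y | y | ⟨y, i'⟩) hy (z | z | ⟨z, l⟩) hz <;> simp at hx hy hz ⊢
      · omega
      · omega
      · simp [Subsingleton.elim i l]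
      · simp [Subsingleton.elim i l]
    · refine Or.inl ⟨p, by omega, _, hl, ClusterOn.mono
        ((ClusterOn.erase (n := i + 1) (B' := {.inr (i, j)}ᶜ) hcol (by simp) (by simp) ?_).image
          (joinInr _ _)) ?_ (by simp)⟩
      · rintro (x | ⟨x, l⟩)
        · simp
        · simp [Subsingleton.elim l j, Fin.val_inj]
      · rintro (x | x)
        · simp
        · exact fun h => ⟨x, by simpa using h.1, rfl⟩

lemma isCore_two {p : ℕ} (hp : 1 ≤ p) :
    IsCore p 2 (join (K 1) (copies 2 (K 2) ⊕g copies p (K 1))) := by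
  have : NeZero p := ⟨by omega⟩
  have hcol : IsClusterColoring (copies 2 (K 2) ⊕g copies p (K 1)) Set.univ
      (Sum.elim (fun x => x.1) (fun x => x.1 + 2)) (Finset.range (p + 2)) := by
    constructor
    · rintro (⟨x, i⟩ | x) - <;> simp
      omega
    · rintro (⟨x, i⟩ | ⟨x, i⟩) - (⟨y, j⟩ | ⟨y, j⟩) - hxy
      · simp [Fin.val_inj] at hxy ⊢
        exact hxy
      · simp; omega
      · simp; omega
      · simp [Subsingleton.elim i j, Fin.val_inj] at hxy ⊢
        exact hxy
  have hl : IndepOn (join (K 1) (copies 2 (K 2) ⊕g copies p (K 1))) (Set.range Sum.inl) := by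
    rintro _ ⟨i, rfl⟩ _ ⟨j, rfl⟩
    simp [Subsingleton.elim i j]
  refine ⟨?_, ?_, ?_, ?_, ?_⟩
  · rintro m ⟨A, hA, hB⟩
    by_cases h : ∃ i, .inl i ∈ A
    · obtain ⟨i, hi⟩ := h
      have := hB.card_le (ι := Fin p ⊕ Fin 2)
        (Sum.elim (fun i => .inr (.inr (i, 0))) (fun i => .inr (.inl (i, 0))))
        (fun j => ⟨trivial, fun hj => hA _ hi _ hj (by rcases j with j | j <;> simp)⟩) (by simp)
      simpa using this
    · push Not at h
      have hj : ∀ i, ∃ j, .inr (.inl (i, j)) ∉ A := by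
        intro i
        by_contra! hcon
        exact hA _ (hcon 0) _ (hcon 1) (by simp)
      choose j hj using hj
      have := hB.adj_trans (x := .inr (.inl (0, j 0))) (y := .inl 0) (z := .inr (.inl (1, j 1)))
        ⟨trivial, hj 0⟩ ⟨trivial, h 0⟩ ⟨trivial, hj 1⟩ (by simp) (by simp) (by simp)
      simp at this
  · rintro m ⟨A, hA, hB⟩
    by_contra hm
    by_cases hc : .inr (.inr (0, 0)) ∈ A
    · have hj : ∀ i, ∃ j, .inr (.inl (i, j)) ∉ A := by
        intro i
        by_contra! hcon
        have := hA _ (hcon 0) _ hc _ (hcon 1)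
        simp at this
      choose j hj using hj
      exact hm (hB.two_le ⟨trivial, hj 0⟩ ⟨trivial, hj 1⟩ (by simp) (by simp))
    · have hj : ∀ i, .inr (.inl i) ∈ A := by
        intro i
        by_contra hi
        exact hm (hB.two_le ⟨trivial, hi⟩ ⟨trivial, hc⟩ (by simp) (by simp))
      have := hA _ (hj (0, 0)) _ (hj (1, 0)) _ (hj (0, 1))
      simp at this
  · have hcol' : ClusterOn (copies 2 (K 2)) Set.univ 2 := by
      refine ⟨fun x => x.1, Finset.range 2, by simp, by simp, ?_⟩
      rintro ⟨x, i⟩ - ⟨y, j⟩ - hxy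
      simp [Fin.val_inj] at hxy ⊢
      exact hxy
    refine ⟨(Set.range fun i => .inr (.inl i))ᶜ, ?_, ClusterOn.mono
      ((hcol'.image (Embedding.sumInl (H := copies p (K 1)))).image (joinInr (K 1) _)) ?_ le_rfl⟩
    · rintro (x | x | ⟨x, i⟩) hx (y | y | ⟨y, j⟩) hy (z | z | ⟨z, l⟩) hz <;> simp at hx hy hz ⊢
      · exact Eq.trans
      · rw [Subsingleton.elim i l]
        simp
    · rintro (x | x | x) hx
      · simp at hx
      · exact ⟨_, ⟨x, trivial, rfl⟩, rfl⟩
      · simp at hx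
  · refine ⟨_, hl, ClusterOn.mono (hcol.clusterOn.image (joinInr _ _))
      ?_ (by simp)⟩
    rintro (x | x)
    · simp
    · exact fun _ => ⟨x, trivial, rfl⟩
  · rintro (j | ⟨i, j⟩ | ⟨i, j⟩)
    · refine Or.inl ⟨2, by omega,
        (Set.range fun i => .inr (.inr i)) ∪ (Set.range fun i => .inr (.inl (i, 0))), ?_,
        (clusterOn_range (ι := Fin 2) (f := fun i => .inr (.inl (i, 1))) (by simp)).mono ?_
          (by simp)⟩
      · rintro _ (⟨x, rfl⟩ | ⟨x, rfl⟩) _ (⟨y, rfl⟩ | ⟨y, rfl⟩) <;> simp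
        rw [Subsingleton.elim x.2 y.2]
        simp
      · rintro (x | ⟨x, l⟩ | x) <;> simp
        · exact Subsingleton.elim _ _
        · omega
    · refine Or.inl ⟨1, by omega,
        (Set.range fun i => .inr (.inr i)) ∪ {.inr (.inl (i, j.rev)), .inr (.inl (i.rev, 0))}, ?_,
        ClusterOn.mono (clusterOn_of_clique (B := {.inl 0, .inr (.inl (i.rev, 1))}) ?_) ?_ le_rfl⟩
      · have hi : i ≠ i.rev := by
          revert i
          decide
        rintro _ (⟨x, rfl⟩ | rfl | rfl) _ (⟨y, rfl⟩ | rfl | rfl) <;> simp [hi, hi.symm]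
        rw [Subsingleton.elim x.2 y.2]
        simp
      · rintro _ (rfl | rfl) _ (rfl | rfl) <;> simp
      · rintro (x | ⟨x, l⟩ | x)
        · simp [Subsingleton.elim x 0]
        · simp
          revert x l i j
          decide
        · simp
    · refine Or.inl ⟨p + 1, by omega, _, hl, ClusterOn.mono
        ((ClusterOn.erase (n := i + 2) (B' := {.inr (i, j)}ᶜ) hcol (by simp) (by simp) ?_).image
          (joinInr _ _)) ?_ (by simp)⟩
      · rintro (⟨x, l⟩ | ⟨x, l⟩)
        · simp
          omega
        · simp [Subsingleton.elim l j, Fin.val_inj]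
      · rintro (x | x)
        · simp
        · exact fun h => ⟨x, by simpa using h.1, rfl⟩

end Cores

end PolarCograph

namespace PolarCograph

section Uniqueness

variable {V W X : Type*} {G : SimpleGraph V} {H : SimpleGraph W}

lemma IsCore.nonempty_iso {p t : ℕ} (hG : IsCore p t G) (hH : IsCore p t H) (f : G ↪g H) :
    Nonempty (H ≃g G) := by
  suffices hf : Function.Surjective f from ⟨(RelIso.ofSurjective f hf).symm⟩
  intro v
  by_contra hv
  have hpre : f ⁻¹' {v}ᶜ = Set.univ := by
    ext x
    simpa using fun h => hv ⟨x, h⟩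
  obtain ⟨m, hm, h⟩ | ⟨m, hm, h⟩ := hH.remove v
  · have := hG.le_split m (hpre ▸ h.preimage f)
    omega
  · have := hG.le_polar m (hpre ▸ h.preimage f)
    omega

lemma PolarOn.cmOn {S : Set V} (h : PolarOn G S 0) : CMOn G S := by
  obtain ⟨A, hA, hB⟩ := h
  refine hA.mono fun x hx => ?_
  by_contra hxA
  have := hB.one_le ⟨hx, hxA⟩
  omega

lemma CMOn.polarOn {S : Set V} (h : CMOn G S) : PolarOn G S 0 :=
  ⟨S, h, clusterOn_empty (by simp)⟩

lemma cmOn_union {A I : Set V} (hA : IndepOn G A) (hI : IndepOn G I)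
    (h : ∀ x ∈ A, ∀ y ∈ I, G.Adj x y) : CMOn G (A ∪ I) := by
  rintro x (hx | hx) y (hy | hy) z (hz | hz) hxy hyz
  · exact hA x hx z hz
  · exact absurd (h y hy z hz) hyz
  · exact absurd (h x hx y hy) hxy
  · exact absurd (h x hx y hy) hxy
  · exact absurd (h y hy x hx).symm hxy
  · exact absurd (h y hy x hx).symm hxy
  · exact absurd (h z hz y hy).symm hyz
  · exact hI x hx z hz

lemma _root_.SimpleGraph.Preconnected.exists_adj [Nontrivial V] (h : G.Preconnected) :
    ∃ x y, G.Adj x y := by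
  obtain ⟨x, y, hxy⟩ := exists_pair_ne V
  obtain ⟨w⟩ := h x y
  cases w with
  | nil => exact absurd rfl hxy
  | cons h _ => exact ⟨_, _, h⟩

lemma _root_.SimpleGraph.Preconnected.exists_adj_of_mem (h : G.Preconnected) {X : Set V}
    {x y : V} (hx : x ∈ X) (hy : y ∉ X) : ∃ u ∈ X, ∃ v ∉ X, G.Adj u v := by
  obtain ⟨w⟩ := h x y
  induction w with
  | nil => exact absurd hx hy
  | @cons x u y h w ih =>
    by_cases hu : u ∈ X
    · exact ih hu hy
    · exact ⟨x, hx, u, hu, h⟩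

/-- `H` is the join of an independent set `A` and a cluster, whose components are the colour
classes of `c`, with set of colours `s`. -/
structure IsJoinColoring (H : SimpleGraph W) (A : Set W) (c : W → ℕ) (s : Finset ℕ) : Prop where
  indep : IndepOn H A
  adj_iff : ∀ x ∉ A, ∀ y ∉ A, x ≠ y → (H.Adj x y ↔ c x = c y)
  adj : ∀ x ∈ A, ∀ y ∉ A, H.Adj x y
  exists_color : ∀ n ∈ s, ∃ x ∉ A, c x = n

/-- A connected core is the join of an independent set and a cluster. -/
lemma IsCore.exists_isJoinColoring [Nontrivial W] {p t : ℕ} (h : IsCore p t H)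
    (hH : CographLike H) (hc : H.Preconnected) (hpt : 2 ≤ p + t) :
    ∃ A c s, A.Nonempty ∧ p + t ≤ s.card ∧ IsJoinColoring H A c s := by
  classical
  obtain ⟨A, hA, c, s, -, hcs⟩ := h.split
  have hmem : ∀ x, x ∈ Set.univ \ A ↔ x ∉ A := by simp
  have key : ∀ X : Set W, X.Nonempty → (∀ x ∈ X, ∀ y ∉ X, H.Adj x y) → (∀ x ∈ X, x ∉ A) →
      A = Xᶜ := by
    rintro X ⟨x, hx⟩ hX hXA
    refine Set.Subset.antisymm (fun y hy hyX => hXA y hyX hy) fun y hy => ?_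
    by_contra hyA
    have hcol : ∀ z ∈ Set.univ \ A, z ∈ X → c z = c y := fun z hz hzX =>
      (hcs.adj_iff z hz y ((hmem y).2 hyA) fun h => hy (h ▸ hzX)).1 (hX z hzX y hy)
    have hcol' : ∀ z ∈ Set.univ \ A, c z = c y := by
      intro z hz
      by_cases hzX : z ∈ X
      · exact hcol z hz hzX
      · have hxA := (hmem x).2 (hXA x hx)
        rw [← hcol x hxA hx]
        exact ((hcs.adj_iff x hxA z hz fun h => hzX (h ▸ hx)).1 (hX x hx z hzX)).symm
    have := h.le_split 1 ⟨A, hA, c, {c y}, by simp, fun z hz => by simp [hcol' z hz], hcs.adj_iff⟩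
    omega
  have key' : ∃ X : Set W, X.Nonempty ∧ Xᶜ.Nonempty ∧ (∀ x ∈ X, ∀ y ∉ X, H.Adj x y) ∧
      ∀ x ∈ X, x ∉ A := by
    obtain ⟨X, -, ⟨x, hx⟩, ⟨y, -, hy⟩, hX | hX⟩ := hH Set.univ Set.nontrivial_univ
    · by_cases hXA : ∀ x ∈ X, x ∉ A
      · exact ⟨X, ⟨x, hx⟩, ⟨y, hy⟩, fun x hx y hy => hX x hx y ⟨trivial, hy⟩, hXA⟩
      · push Not at hXA
        obtain ⟨z, hz, hzA⟩ := hXA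
        refine ⟨Xᶜ, ⟨y, hy⟩, ⟨x, by simpa⟩, fun u hu v hv => (hX v (by simpa using hv) u
          ⟨trivial, hu⟩).symm, fun u hu huA => hA z hzA u huA (hX z hz u ⟨trivial, hu⟩)⟩
    · obtain ⟨u, hu, v, hv, huv⟩ := hc.exists_adj_of_mem hx hy
      exact absurd huv (hX u hu v ⟨trivial, hv⟩)
  obtain ⟨X, hX, hX', hadj, hXA⟩ := key'
  obtain rfl := key X hX hadj hXA
  have hs' : IsClusterColoring H (Set.univ \ Xᶜ) c (s.filter fun n => ∃ x ∉ Xᶜ, c x = n) :=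
    ⟨fun x hx => Finset.mem_filter.2 ⟨hcs.mem x hx, x, hx.2, rfl⟩, hcs.adj_iff⟩
  exact ⟨Xᶜ, c, _, hX', h.le_split _ ⟨Xᶜ, hA, hs'.clusterOn⟩, hA,
    fun x hx y hy => hcs.adj_iff x ⟨trivial, hx⟩ y ⟨trivial, hy⟩,
    fun x hx y hy => (hadj y (by simpa using hy) x hx).symm,
    fun n hn => (Finset.mem_filter.1 hn).2⟩

lemma IsJoinColoring.exists_colors {A : Set W} {c : W → ℕ} {s T : Finset ℕ}
    (h : IsJoinColoring H A c s) (hT : T ⊆ s) {n : ℕ} (hn : n ≤ T.card) :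
    ∃ z : Fin n → W, (∀ i, z i ∉ A) ∧ (∀ i, c (z i) ∈ T) ∧ Function.Injective (c ∘ z) := by
  have hg : ∀ i : Fin n, ∃ x ∉ A, c x = T.equivFin.symm (Fin.castLE hn i) := fun i =>
    h.exists_color _ (hT (Subtype.prop _))
  choose z hzA hz using hg
  refine ⟨z, hzA, fun i => hz i ▸ Subtype.prop _, fun i j hij => ?_⟩
  simpa [hz, Subtype.coe_inj] using hij

lemma IsJoinColoring.nonempty_embedding {A : Set W} {c : W → ℕ} {s : Finset ℕ}
    (h : IsJoinColoring H A c s) {G' : SimpleGraph X} {f : V → W} {g : X → W}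
    (hG : ∀ x y, ¬ G.Adj x y) (hfA : ∀ x, f x ∈ A) (hf : Function.Injective f)
    (hgA : ∀ x, g x ∉ A) (hg : Function.Injective g)
    (hgc : ∀ x y, x ≠ y → (G'.Adj x y ↔ c (g x) = c (g y))) : Nonempty (join G G' ↪g H) := by
  refine ⟨⟨⟨Sum.elim f g, hf.sumElim hg fun x y hxy => hgA y (hxy ▸ hfA x)⟩, ?_⟩⟩
  rintro (x | x) (y | y)
  · simp [hG, h.indep _ (hfA x) _ (hfA y)]
  · simp [h.adj _ (hfA x) _ (hgA y)]
  · simp [(h.adj _ (hfA y) _ (hgA x)).symm]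
  · by_cases hxy : x = y
    · simp [hxy]
    · simp [hgc x y hxy, h.adj_iff _ (hgA x) _ (hgA y) (hg.ne hxy)]

lemma IsJoinColoring.not_adj {A : Set W} {c : W → ℕ} {s : Finset ℕ} (h : IsJoinColoring H A c s)
    {x y : W} (hx : x ∉ A) (hy : y ∉ A) (hxy : c x ≠ c y) : ¬ H.Adj x y ∧ x ≠ y := by
  have hne : x ≠ y := fun h => hxy (h ▸ rfl)
  exact ⟨fun hadj => hxy ((h.adj_iff x hx y hy hne).1 hadj), hne⟩

lemma IsJoinColoring.color_eq {A : Set W} {c : W → ℕ} {s : Finset ℕ} (h : IsJoinColoring H A c s)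
    {x y : W} (hx : x ∉ A) (hy : y ∉ A) (hxy : H.Adj x y) : c x = c y :=
  (h.adj_iff x hx y hy hxy.ne).1 hxy

lemma IsJoinColoring.exists_adj {A : Set W} {c : W → ℕ} {s : Finset ℕ}
    (h : IsJoinColoring H A c s) (h0 : ¬ PolarOn H Set.univ 0) :
    ∃ x ∉ A, ∃ y ∉ A, H.Adj x y := by
  by_contra! hcon
  refine h0 (CMOn.polarOn ((cmOn_union (I := Aᶜ) h.indep (fun x hx y hy => hcon x hx y hy)
    fun x hx y hy => h.adj x hx y hy).mono (by simp)))

lemma IsCore.iso_zero [Finite W] [Nontrivial W] {p : ℕ} (hp : 1 ≤ p) (h : IsCore p 0 H)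
    (hH : CographLike H) (hc : H.Preconnected) :
    Nonempty (H ≃g completeBipartiteGraph (Fin p) (Fin p)) := by
  suffices hemb : Nonempty (completeBipartiteGraph (Fin p) (Fin p) ↪g H) from
    hemb.elim fun f => (isCore_zero hp).nonempty_iso h f
  rcases hp.eq_or_lt with rfl | hp
  · obtain ⟨x, y, hxy⟩ := hc.exists_adj
    refine ⟨⟨⟨Sum.elim (fun _ => x) (fun _ => y), ?_⟩, ?_⟩⟩
    · rintro (i | i) (j | j) <;> simp [hxy.ne, hxy.ne', Subsingleton.elim i j]
    · rintro (i | i) (j | j)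
      · exact iff_of_false (H.loopless.irrefl x) (by simp)
      · exact iff_of_true hxy (by simp)
      · exact iff_of_true hxy.symm (by simp)
      · exact iff_of_false (H.loopless.irrefl y) (by simp)
  · obtain ⟨A, c, s, hA, hs, hcol⟩ := h.exists_isJoinColoring hH hc hp
    have hcm := h.polar.cmOn
    have hind : IndepOn H Aᶜ := by
      intro x hx y hy hxy
      obtain ⟨n, hn, hne⟩ := Finset.exists_mem_ne (show 1 < s.card by omega) (c x)
      obtain ⟨z, hz, rfl⟩ := hcol.exists_color n hn
      have hcxy := hcol.color_eq hx hy hxy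
      exact hcm x trivial z trivial y trivial (hcol.not_adj hx hz hne.symm).1
        (hcol.not_adj hz hy (hcxy ▸ hne)).1 hxy
    have hAcard : p ≤ A.ncard := by
      refine h.le_split _ ⟨Aᶜ, hind, ?_⟩
      rw [← Set.compl_eq_univ_sdiff, compl_compl]
      exact clusterOn_of_indepOn hcol.indep (Set.toFinite A)
    obtain ⟨z, hzA, -, hz⟩ := hcol.exists_colors subset_rfl hs
    rw [← Nat.card_coe_set_eq] at hAcard
    rw [completeBipartiteGraph_eq_join]
    refine hcol.nonempty_embedding (f := fun i => ((Finite.equivFin A).symm (Fin.castLE hAcard i)))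
      (g := z) (by simp) (fun i => Subtype.prop _) ?_ hzA hz.of_comp ?_
    · exact fun i j hij => Fin.castLE_injective hAcard
        ((Finite.equivFin A).symm.injective (Subtype.ext hij))
    · intro i j hij
      simpa using hz.ne hij

lemma exists_adj_of_not_indepOn {A : Set W} {c : W → ℕ} (n : ℕ)
    (h0 : ¬ IndepOn H {x | x ∉ A ∧ c x ≠ n}) :
    ∃ u ∉ A, ∃ w ∉ A, H.Adj u w ∧ c u ≠ n := by
  simp only [IndepOn, not_forall, not_not] at h0
  obtain ⟨u, hu, w, hw, huw⟩ := h0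
  exact ⟨u, hu.1, w, hw.1, huw, hu.2⟩

lemma CMOn.false_of_adj {A : Set V} (h : CMOn G A) {x y z : V} (hx : x ∈ A) (hy : y ∈ A)
    (hz : z ∈ A) (hxy : G.Adj x y) (hxz : ¬ G.Adj x z) (hyz : ¬ G.Adj y z) : False :=
  h x hx z hz y hy hxz (fun h => hyz h.symm) hxy

lemma IsCore.iso_one [Nontrivial W] {p : ℕ} (hp : 1 ≤ p) (h : IsCore p 1 H)
    (hH : CographLike H) (hc : H.Preconnected) :
    Nonempty (H ≃g join (K 2)ᶜ (K 2 ⊕g copies p (K 1))) := by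
  suffices hemb : Nonempty (join (K 2)ᶜ (K 2 ⊕g copies p (K 1)) ↪g H) from
    hemb.elim fun f => (isCore_one hp).nonempty_iso h f
  obtain ⟨A, c, s, hA, hs, hcol⟩ := h.exists_isJoinColoring hH hc (by omega)
  obtain ⟨x, hx, y, hy, hxy⟩ := hcol.exists_adj fun h0 => by
    have := h.le_polar 0 h0
    omega
  have hcxy := hcol.color_eq hx hy hxy
  rcases A.subsingleton_or_nontrivial with hA' | ⟨a, ha, a', ha', haa'⟩
  · exfalso
    obtain ⟨a, ha⟩ := hA
    have hAa : ∀ z, z ∉ A ↔ z ≠ a := fun z =>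
      ⟨fun hz h => hz (h ▸ ha), fun hz h => hz (hA' h ha)⟩
    obtain ⟨u, hu, w, hw, huw, hux⟩ := exists_adj_of_not_indepOn (H := H) (A := A) (c := c) (c x) fun hind => by
      have h1 := h.le_split 1 ⟨{z | z ∉ A ∧ c z ≠ c x} ∪ {x}, ?_, clusterOn_of_clique ?_⟩
      · omega
      · rintro u (hu | rfl) v (hv | rfl)
        · exact hind u hu v hv
        · exact (hcol.not_adj hu.1 hx hu.2).1
        · exact (hcol.not_adj hx hv.1 hv.2.symm).1
        · exact H.loopless.irrefl _
      · rintro u ⟨-, hu⟩ v ⟨-, hv⟩ huv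
        simp only [Set.mem_union, Set.mem_ofPred_eq, Set.mem_singleton_iff, not_or, not_and,
          not_not] at hu hv
        by_cases huA : u ∈ A <;> by_cases hvA : v ∈ A
        · exact absurd (hA' huA hvA) huv
        · exact hcol.adj u huA v hvA
        · exact (hcol.adj v hvA u huA).symm
        · rw [hcol.adj_iff u huA v hvA huv, hu.1 huA, hv.1 hvA]
    have hcuw := hcol.color_eq hu hw huw
    have hxu := hcol.not_adj hx hu hux.symm
    have hxw := hcol.not_adj hx hw (hcuw ▸ hux.symm)
    have hyu := hcol.not_adj hy hu (hcxy ▸ hux.symm)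
    have hyw := hcol.not_adj hy hw (hcxy ▸ hcuw ▸ hux.symm)
    rcases hp.eq_or_lt with rfl | hp
    · obtain ⟨m, hm, A', hA', hB'⟩ | ⟨m, hm, h'⟩ := h.remove a
      · have hex : ∀ {u v}, H.Adj u v → u ∈ A' → v ∉ A' := fun h hu hv => hA' _ hu _ hv h
        have hB2 : ∀ {u v}, u ∉ A → v ∉ A → ¬ H.Adj u v ∧ u ≠ v → u ∉ A' → v ∈ A' := by
          intro u v hu hv huv hu'
          by_contra hv'
          have := hB'.two_le ⟨(hAa u).1 hu, hu'⟩ ⟨(hAa v).1 hv, hv'⟩ huv.1 huv.2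
          omega
        by_cases hxA : x ∈ A'
        · exact hex huw (hB2 hy hu hyu (hex hxy hxA)) (hB2 hy hw hyw (hex hxy hxA))
        · exact hex huw (hB2 hx hu hxu hxA) (hB2 hx hw hxw hxA)
      · obtain rfl : m = 0 := by omega
        exact h'.cmOn.false_of_adj ((hAa x).1 hx) ((hAa y).1 hy) ((hAa u).1 hu) hxy hxu.1 hyu.1
    · obtain ⟨n, hn⟩ : ((s.erase (c x)).erase (c u)).Nonempty := by
        rw [← Finset.card_pos]
        have h1 := Finset.pred_card_le_card_erase (s := s) (a := c x)
        have h2 := Finset.pred_card_le_card_erase (s := s.erase (c x)) (a := c u)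
        omega
      obtain ⟨z, hz, rfl⟩ := hcol.exists_color n (Finset.mem_of_mem_erase
        (Finset.mem_of_mem_erase hn))
      have hzu := Finset.ne_of_mem_erase hn
      have hzx := Finset.ne_of_mem_erase (Finset.mem_of_mem_erase hn)
      have hxz := hcol.not_adj hx hz hzx.symm
      have hyz := hcol.not_adj hy hz (hcxy ▸ hzx.symm)
      have huz := hcol.not_adj hu hz hzu.symm
      have hwz := hcol.not_adj hw hz (hcuw ▸ hzu.symm)
      obtain ⟨A', hA', hB'⟩ := h.polar
      have hB2 : ∀ {u v}, ¬ H.Adj u v ∧ u ≠ v → u ∉ A' → v ∈ A' := by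
        intro u v huv hu'
        by_contra hv'
        have := hB'.two_le ⟨trivial, hu'⟩ ⟨trivial, hv'⟩ huv.1 huv.2
        omega
      by_cases hxA : x ∈ A'
      · by_cases hyA : y ∈ A'
        · by_cases huA : u ∈ A'
          · exact hA'.false_of_adj hxA hyA huA hxy hxu.1 hyu.1
          · exact hA'.false_of_adj hxA hyA (hB2 huz huA) hxy hxz.1 hyz.1
        · exact hA'.false_of_adj (hB2 hyu hyA) (hB2 hyw hyA) (hB2 hyz hyA) huw huz.1 hwz.1
      · exact hA'.false_of_adj (hB2 hxu hxA) (hB2 hxw hxA) (hB2 hxz hxA) huw huz.1 hwz.1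
  · obtain ⟨z, hzA, hzs, hz⟩ := hcol.exists_colors (Finset.erase_subset (c x) s) (n := p) (by
      have := Finset.pred_card_le_card_erase (s := s) (a := c x)
      omega)
    have hzx : ∀ i, c (z i) ≠ c x := fun i => Finset.ne_of_mem_erase (hzs i)
    have hzx' : ∀ i, z i ≠ x := fun i h => hzx i (h ▸ rfl)
    have hzy' : ∀ i, z i ≠ y := fun i h => hzx i (h ▸ hcxy.symm)
    have hzi : ∀ i j, c (z i) = c (z j) ↔ i = j := fun i j => hz.eq_iff
    have hzi' : ∀ i j, z i = z j ↔ i = j := fun i j => hz.of_comp.eq_iff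
    refine hcol.nonempty_embedding (f := ![a, a']) (g := Sum.elim ![x, y] fun i => z i.1)
      (by simp) ?_ ?_ ?_ ?_ ?_
    · simp [Fin.forall_fin_two, ha, ha']
    · simp [Function.Injective, Fin.forall_fin_two, haa', haa'.symm]
    · rintro (i | i)
      · revert i
        simp [Fin.forall_fin_two, hx, hy]
      · exact hzA _
    · rintro (i | ⟨i, i'⟩) (j | ⟨j, j'⟩)
      · revert i j
        simp [Fin.forall_fin_two, hxy.ne, hxy.ne']
      · revert i
        simp [Fin.forall_fin_two, (hzx' _).symm, (hzy' _).symm]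
      · revert j
        simp [Fin.forall_fin_two, hzx', hzy']
      · simp [hzi', Subsingleton.elim i' j']
    · rintro (i | ⟨i, i'⟩) (j | ⟨j, j'⟩)
      · revert i j
        simp [Fin.forall_fin_two, hcxy]
      · revert i
        simp [Fin.forall_fin_two, ← hcxy, (hzx _).symm]
      · revert j
        simp [Fin.forall_fin_two, ← hcxy, hzx]
      · simp [hzi, Subsingleton.elim i' j']

lemma IsCore.iso_two [Nontrivial W] {p : ℕ} (hp : 1 ≤ p) (h : IsCore p 2 H)
    (hH : CographLike H) (hc : H.Preconnected) :
    Nonempty (H ≃g join (K 1) (copies 2 (K 2) ⊕g copies p (K 1))) := by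
  suffices hemb : Nonempty (join (K 1) (copies 2 (K 2) ⊕g copies p (K 1)) ↪g H) from
    hemb.elim fun f => (isCore_two hp).nonempty_iso h f
  obtain ⟨A, c, s, ⟨a, ha⟩, hs, hcol⟩ := h.exists_isJoinColoring hH hc (by omega)
  obtain ⟨x, hx, y, hy, hxy⟩ := hcol.exists_adj fun h0 => by
    have := h.le_polar 0 h0
    omega
  obtain ⟨u, hu, w, hw, huw, hux⟩ := exists_adj_of_not_indepOn (H := H) (A := A) (c := c) (c x) fun hind => by
    have h1 := h.le_polar 1 ⟨_, cmOn_union hcol.indep hind fun u hu v hv => hcol.adj u hu v hv.1,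
      clusterOn_of_clique ?_⟩
    · omega
    · rintro u ⟨-, hu⟩ v ⟨-, hv⟩ huv
      simp only [Set.mem_union, Set.mem_ofPred_eq, not_or, not_and, not_not] at hu hv
      rw [hcol.adj_iff u hu.1 v hv.1 huv, hu.2 hu.1, hv.2 hv.1]
  have hcxy := hcol.color_eq hx hy hxy
  have hcuw := hcol.color_eq hu hw huw
  obtain ⟨z, hzA, hzs, hz⟩ := hcol.exists_colors
    ((Finset.erase_subset (c u) _).trans (Finset.erase_subset (c x) s)) (n := p) (by
      have h1 := Finset.pred_card_le_card_erase (s := s) (a := c x)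
      have h2 := Finset.pred_card_le_card_erase (s := s.erase (c x)) (a := c u)
      omega)
  have hzu : ∀ i, c (z i) ≠ c u := fun i => Finset.ne_of_mem_erase (hzs i)
  have hzx : ∀ i, c (z i) ≠ c x := fun i =>
    Finset.ne_of_mem_erase (Finset.mem_of_mem_erase (hzs i))
  have hzi : ∀ i j, c (z i) = c (z j) ↔ i = j := fun i j => hz.eq_iff
  have hzi' : ∀ i j, z i = z j ↔ i = j := fun i j => hz.of_comp.eq_iff
  let e : Fin 2 × Fin 2 → W := fun i => ![![x, y], ![u, w]] i.1 i.2
  have he : ∀ i, e i ∉ A ∧ c (e i) = ![c x, c u] i.1 := by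
    simp [e, Fin.forall_fin_two, hx, hy, hu, hw, ← hcxy, ← hcuw]
  have hze : ∀ i j, c (z i) ≠ c (e j) := by
    intro i j
    rw [(he j).2]
    obtain ⟨j, -⟩ := j
    revert j
    simp [Fin.forall_fin_two, hzx, hzu]
  have hce : ∀ i j, c (e i) = c (e j) ↔ i.1 = j.1 := by
    simp [he, Fin.forall_fin_two, hux, hux.symm]
  have hei : Function.Injective e := by
    rintro ⟨i, i'⟩ ⟨j, j'⟩ hij
    obtain rfl : i = j := (hce _ _).1 (congrArg c hij)
    revert i i' j'
    simp [e, Fin.forall_fin_two, hxy.ne, hxy.ne', huw.ne, huw.ne']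
  refine hcol.nonempty_embedding (f := fun _ => a) (g := Sum.elim e fun i => z i.1)
    (fun i j => by simp [Subsingleton.elim i j]) (fun _ => ha)
    (fun i j _ => Subsingleton.elim i j) ?_ ?_ ?_
  · rintro (i | i)
    · exact (he i).1
    · exact hzA _
  · refine hei.sumElim ?_ fun i j h => hze j.1 i (congrArg c h).symm
    rintro ⟨i, i'⟩ ⟨j, j'⟩ hij
    rw [(hzi' i j).1 hij, Subsingleton.elim i' j']
  · rintro (⟨i, i'⟩ | ⟨i, i'⟩) (⟨j, j'⟩ | ⟨j, j'⟩) hij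
    · simp [hce] at hij ⊢
      exact hij
    · simp [(hze _ _).symm]
    · simp [hze]
    · simp [hzi, Subsingleton.elim i' j'] at hij ⊢
      exact hij

lemma nontrivial_sum (α β : Type*) [Nonempty α] [Nonempty β] : Nontrivial (α ⊕ β) :=
  ⟨.inl (Classical.arbitrary α), .inr (Classical.arbitrary β), by simp⟩

/-- The passage from cores to minimal obstructions. -/
lemma isMinimalObstruction_and_unique {X : Type} [Finite X] [Nontrivial X] {Γ : SimpleGraph X}
    {p t k : ℕ} (hp : 1 ≤ p) (hpk : p + t ≤ k + 1) (hcore : IsCore p t Γ) (hcog : CographLike Γ)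
    (hconn : Γ.Preconnected)
    (huniq : ∀ (W : Type u) [Finite W] [Nontrivial W] (H : SimpleGraph W), IsCore p t H →
      CographLike H → H.Preconnected → Nonempty (H ≃g Γ)) :
    IsMinimalObstruction ⊤ k (withSmall p (k + 1 - p - t) Γ) ∧
      (p + t ≤ k → ∀ (V : Type u) [Finite V] (G : SimpleGraph V),
        (IsMinimalObstruction ⊤ k G ∧ HasType (k + 2 - t) p G) ↔
          Nonempty (G ≃g withSmall p (k + 1 - p - t) Γ)) := by
  obtain ⟨b, hb⟩ := Nat.exists_eq_add_of_le hpk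
  have h1 : k + 1 - p - t = b := by omega
  have h2 : k + 2 - t = p + b + 1 := by omega
  rw [h1, h2]
  have hmin := hcore.isMinimalObstruction hcog hp (b := b) (k := k) (by omega)
  refine ⟨hmin, fun hlt V _ G => ⟨?_, ?_⟩⟩
  · rintro ⟨hG, hT⟩
    rw [isMinimalObstruction_iff] at hG
    obtain ⟨hcogG, hno, hrem⟩ := hG
    obtain ⟨C, hC, ⟨e⟩⟩ := hT.exists_iso_withSmall hp hno hrem
    have : Nontrivial C.supp := Set.nontrivial_coe_sort.2 hC
    have hcoreC : IsCore p t C.toSimpleGraph := by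
      refine isCore_of_withSmall (b := b) (k := k) hp (by omega) (by omega) (fun h => hno ?_)
        fun v => ?_
      · simpa using h.preimage e.symm.toEmbedding
      · refine ((hrem (e v)).preimage e.toEmbedding).mono (fun x hx => ?_) le_rfl
        simpa using hx
    obtain ⟨f⟩ := huniq _ C.toSimpleGraph hcoreC (hcogG.comap (Embedding.induce C.supp))
      C.connected_toSimpleGraph.preconnected
    exact ⟨e.symm.trans (Iso.sumCongr Iso.refl f)⟩
  · rintro ⟨e⟩
    refine ⟨?_, hasType_of_iso_withSmall hconn e⟩
    rw [isMinimalObstruction_iff] at hmin ⊢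
    obtain ⟨hcogG, hno, hrem⟩ := hmin
    refine ⟨hcogG.comap e.toEmbedding, fun h => hno ?_, fun v => ?_⟩
    · simpa using h.preimage e.symm.toEmbedding
    · refine ((hrem (e v)).preimage e.toEmbedding).mono (fun x hx => ?_) le_rfl
      simpa using hx

end Uniqueness

end PolarCograph

theorem mainTheorem11 (p k : ℕ) :
    (1 ≤ p → p ≤ k + 1 →
      PolarCograph.IsMinimalObstruction ⊤ k
        (PolarCograph.withSmall p (k + 1 - p) (completeBipartiteGraph (Fin p) (Fin p))) ∧
      (p ≤ k → ∀ (V : Type u) [Finite V] (G : SimpleGraph V),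
        (PolarCograph.IsMinimalObstruction ⊤ k G ∧ PolarCograph.HasType (k + 2) p G) ↔
          Nonempty (G ≃g
            PolarCograph.withSmall p (k + 1 - p) (completeBipartiteGraph (Fin p) (Fin p))))) ∧
    (1 ≤ p → p ≤ k →
      PolarCograph.IsMinimalObstruction ⊤ k
        (PolarCograph.withSmall p (k - p)
          (PolarCograph.join (PolarCograph.K 2)ᶜ
            (PolarCograph.K 2 ⊕g PolarCograph.copies p (PolarCograph.K 1)))) ∧
      (p + 1 ≤ k → ∀ (V : Type u) [Finite V] (G : SimpleGraph V),
        (PolarCograph.IsMinimalObstruction ⊤ k G ∧ PolarCograph.HasType (k + 1) p G) ↔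
          Nonempty (G ≃g
            PolarCograph.withSmall p (k - p)
              (PolarCograph.join (PolarCograph.K 2)ᶜ
                (PolarCograph.K 2 ⊕g PolarCograph.copies p (PolarCograph.K 1)))))) ∧
    (1 ≤ p → p + 1 ≤ k →
      PolarCograph.IsMinimalObstruction ⊤ k
        (PolarCograph.withSmall p (k - p - 1)
          (PolarCograph.join (PolarCograph.K 1)
            (PolarCograph.copies 2 (PolarCograph.K 2) ⊕g
              PolarCograph.copies p (PolarCograph.K 1)))) ∧
      (p + 2 ≤ k → ∀ (V : Type u) [Finite V] (G : SimpleGraph V),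
        (PolarCograph.IsMinimalObstruction ⊤ k G ∧ PolarCograph.HasType k p G) ↔
          Nonempty (G ≃g
            PolarCograph.withSmall p (k - p - 1)
              (PolarCograph.join (PolarCograph.K 1)
                (PolarCograph.copies 2 (PolarCograph.K 2) ⊕g
                  PolarCograph.copies p (PolarCograph.K 1)))))) := by
  refine ⟨fun hp hpk => ?_, fun hp hpk => ?_, fun hp hpk => ?_⟩
  · have : Nonempty (Fin p) := ⟨⟨0, hp⟩⟩
    have := PolarCograph.nontrivial_sum (Fin p) (Fin p)
    have h := PolarCograph.isMinimalObstruction_and_unique hp (k := k) (t := 0) (by omega)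
      (PolarCograph.isCore_zero hp)
      (by
        rw [PolarCograph.completeBipartiteGraph_eq_join]
        exact .join .bot .bot)
      (by
        rw [PolarCograph.completeBipartiteGraph_eq_join]
        exact PolarCograph.preconnected_join)
      fun W _ _ H h₁ h₂ h₃ => h₁.iso_zero hp h₂ h₃
    exact ⟨h.1, h.2⟩
  · have := PolarCograph.nontrivial_sum (Fin 2) (Fin 2 ⊕ Fin p × Fin 1)
    have h := PolarCograph.isMinimalObstruction_and_unique hp (k := k) (t := 1) (by omega)
      (PolarCograph.isCore_one hp) (.join (.compl .top) (.sum .top (.copies p .top)))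
      PolarCograph.preconnected_join fun W _ _ H h₁ h₂ h₃ => h₁.iso_one hp h₂ h₃
    rw [show k + 1 - p - 1 = k - p by omega, show k + 2 - 1 = k + 1 by omega] at h
    exact h
  · have := PolarCograph.nontrivial_sum (Fin 1) (Fin 2 × Fin 2 ⊕ Fin p × Fin 1)
    have h := PolarCograph.isMinimalObstruction_and_unique hp (k := k) (t := 2) (by omega)
      (PolarCograph.isCore_two hp) (.join .top (.sum (.copies 2 .top) (.copies p .top)))
      PolarCograph.preconnected_join fun W _ _ H h₁ h₂ h₃ => h₁.iso_two hp h₂ h₃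
    rw [show k + 1 - p - 2 = k - p - 1 by omega, show k + 2 - 2 = k by omega] at h
    exact h
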